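/- **Theorem 1.3.** Let $5\le d\le 7$, $N\ge 2$. Let $H^4(\mathbb R^d)$ be the space of real $\phi\in L^2(\mathbb R^d)$ with $\Delta^2\phi\in L^2(\mathbb R^d)$, with norm $\|\phi\|_{H^4}^2=\|\phi\|_{L^2}^2+\|\Delta^2\phi\|_{L^2}^2$ (derivatives in the sense of distributions), and for $u=(u_1,\dots,u_N)$ put $\|u\|_{H^4(\mathbb R^d,\mathbb R^N)}^2=\sum_{m}\|u_m\|_{H^4}^2$. Let $f_m,H_m:\mathbb R^d\to\mathbb R$ $(1\le m\le N)$ lie in $L^1(\mathbb R^d)\cap L^2(\mathbb R^d)$, with $f_m$ not almost everywhere zero for some $m$, and $$H^2:=\sum_{m=1}^N\|H_m\|_{L^1}^2>0,\qquad Q^2:=\sum_{m=1}^N\|H_m\|_{L^2}^2>0.$$ There is a constant $c_e>0$ with $\|\phi\|_{L^\infty}\le c_e\|\phi\|_{H^4}$ for all $\phi\in H^4(\mathbb R^d)$, and there is a unique $u_0\in H^4(\mathbb R^d,\mathbb R^N)$ with $(-\Delta+\Delta^2)u_{0,m}=f_m$ for $1\le m\le N$. Fix any such $c_e$, write $A:=\|u_0\|_{H^4(\mathbb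 R^d,\mathbb R^N)}+1$, and let $I:=\{z\in\mathbb R^N:\ |z|\le c_eA\}$. Let $M>0$ and let $g=(g_1,\dots,g_N):\mathbb R^N\to\mathbb R^N$ be $C^2$ on $I$, not identically zero on $I$, with $g_m(0)=0$, $\nabla g_m(0)=0$ for all $m$, and $$\sum_{m=1}^N\Big(\|g_m\|_{C(I)}+\sum_{n=1}^N\|\partial_n g_m\|_{C(I)}+\sum_{n,l=1}^N\|\partial_n\partial_l g_m\|_{C(I)}\Big)\le M .$$ Let $\rho\in(0,1]$, $B_\rho:=\{u\in H^4(\mathbb R^d,\mathbb R^N):\ \|u\|_{H^4(\mathbb R^d,\mathbb R^N)}\le\rho\}$, let $\varepsilon_m\ge0$ and $\varepsilon:=\max_m\varepsilon_m$, and suppose $$0<\varepsilon\le\frac{\rho}{MA^2}\left[H^2A^{\frac8d-2}\Big(\frac{|S^d|}{4}\Big)^{\frac4d}\frac{d}{(d-4)(2\pi)^4}+Q^2\right]^{-\frac12},$$ where $|S^d|$ is the surface measure of the unit sphere of $\mathbb R^d$. Then: 1. For every $v\in B_\rho$ the system $$(-\Delta+\Delta^2)u_m(x)=\varepsilon_m\int_{\mathbb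 R^d}H_m(x-y)\,g_m(u_0(y)+v(y))\,dy,\qquad 1\le m\le N,$$ has a unique solution $u=:T_gv$ in $H^4(\mathbb R^d,\mathbb R^N)$, and $T_gv\in B_\rho$. 2. $T_g:B_\rho\to B_\rho$ is a strict contraction: there is $q\in[0,1)$ with $\|T_gv_1-T_gv_2\|_{H^4(\mathbb R^d,\mathbb R^N)}\le q\,\|v_1-v_2\|_{H^4(\mathbb R^d,\mathbb R^N)}$ for all $v_1,v_2\in B_\rho$. 3. $T_g$ has a unique fixed point $u_p\in B_\rho$, and $u_p$ is the only $u\in B_\rho$ that solves $$(-\Delta+\Delta^2)u_m(x)=\varepsilon_m\int_{\mathbb R^d}H_m(x-y)\,g_m(u_0(y)+u(y))\,dy,\qquad 1\le m\le N.$$ 4. $u:=u_0+u_p\in H^4(\mathbb R^d,\mathbb R^N)$ solves the stationary system $$(\Delta-\Delta^2)u_m(x)+\int_{\mathbb R^d}\varepsilon_mH_m(x-y)\,g_m(u(y))\,dy+f_m(x)=0,\qquad 1\le m\le N.$$ -/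

import Mathlib

open MeasureTheory
open scoped SchwartzMap Laplacian

noncomputable section

namespace BiLaplace

/-- Euclidean space `ℝ^d`. -/
abbrev E (d : ℕ) : Type := EuclideanSpace ℝ (Fin d)

/-- The real Hilbert space `L²(ℝ^d)` of real-valued functions (Lebesgue measure). -/
abbrev L2 (d : ℕ) : Type := Lp ℝ 2 (volume : Measure (E d))

/-- A real `L²` function viewed as a (complex-valued) tempered distribution, so that all its
derivatives make sense as distributions. -/
def toDist {d : ℕ} (φ : L2 d) : 𝓢'(E d, ℂ) :=
  ((Complex.ofRealCLM.compLp φ : Lp ℂ 2 (volume : Measure (E d))) : 𝓢'(E d, ℂ))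

theorem toDist_injective {d : ℕ} : Function.Injective (toDist (d := d)) := by
  intro φ ψ h
  have hker := Lp.ker_toTemperedDistributionCLM_eq_bot (E := E d) (F := ℂ) (p := 2)
    (μ := (volume : Measure (E d)))
  have h2 := LinearMap.ker_eq_bot.mp hker h
  apply Lp.ext
  have h3 := Complex.ofRealCLM.coeFn_compLp φ
  have h4 := Complex.ofRealCLM.coeFn_compLp ψ
  rw [h2] at h3
  filter_upwards [h3, h4] with x hx hy
  have := hx.symm.trans hy
  simpa using this

/-- `w` is the bi-Laplacian `Δ²φ` of `φ` in the sense of distributions. -/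
def IsBiLap {d : ℕ} (φ w : L2 d) : Prop := Δ (Δ (toDist φ)) = toDist w

/-- Membership in `H⁴(ℝ^d)`: `φ ∈ L²` and `Δ²φ ∈ L²`. -/
def MemH4 {d : ℕ} (φ : L2 d) : Prop := ∃ w : L2 d, IsBiLap φ w

open Classical in
/-- The bi-Laplacian `Δ²φ ∈ L²` of `φ ∈ H⁴` (the value is `0` if `φ ∉ H⁴`). -/
def biLap {d : ℕ} (φ : L2 d) : L2 d := if h : MemH4 φ then h.choose else 0

theorem IsBiLap.biLap_eq {d : ℕ} {φ w : L2 d} (h : IsBiLap φ w) : biLap φ = w := by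
  have hm : MemH4 φ := ⟨w, h⟩
  have h1 : IsBiLap φ (biLap φ) := by
    rw [biLap, dif_pos hm]
    exact hm.choose_spec
  exact toDist_injective (Eq.trans (Eq.symm h1) h)

/-- Membership in `H⁴(ℝ^d, ℝ^N)`. -/
def MemH4Vec {d N : ℕ} (u : Fin N → L2 d) : Prop := ∀ m, MemH4 (u m)

/-- The `H⁴(ℝ^d)` norm `(‖φ‖² + ‖Δ²φ‖²)^{1/2}`. -/
def h4Norm {d : ℕ} (φ : L2 d) : ℝ := √(‖φ‖ ^ 2 + ‖biLap φ‖ ^ 2)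

/-- The `H⁴(ℝ^d, ℝ^N)` norm `(∑ₘ ‖uₘ‖²)^{1/2}`. -/
def h4NormVec {d N : ℕ} (u : Fin N → L2 d) : ℝ := √(∑ m, h4Norm (u m) ^ 2)

/-- The closed ball `B_ρ` of `H⁴(ℝ^d, ℝ^N)`. -/
def ballH4 (d N : ℕ) (ρ : ℝ) : Set (Fin N → L2 d) := {u | MemH4Vec u ∧ h4NormVec u ≤ ρ}

/-- `c` is a constant of the embedding `‖φ‖_∞ ≤ c ‖φ‖_{H⁴}`. -/
def IsEmbeddingConst (d : ℕ) (c : ℝ) : Prop :=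
  0 < c ∧ ∀ φ : L2 d, MemH4 φ →
    eLpNorm (φ : E d → ℝ) ⊤ volume ≤ ENNReal.ofReal (c * h4Norm φ)

/-- `u` solves `(-Δ + Δ²) u = F` (in the sense of distributions), where `F ∈ L²`. -/
def SolvesLinear {d : ℕ} (F : E d → ℝ) (u : L2 d) : Prop :=
  ∃ w : L2 d, (w : E d → ℝ) =ᵐ[volume] F ∧
    -Δ (toDist u) + Δ (Δ (toDist u)) = toDist w

/-- The vector `u(x) ∈ ℝ^N`. -/
def evalVec {d N : ℕ} (u : Fin N → L2 d) (x : E d) : E N :=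
  WithLp.toLp 2 fun j => (u j : E d → ℝ) x

/-- The integral term `∫ K(x - y) g(u(y)) dy`. -/
def integralTerm {d N : ℕ} (K : E d → ℝ) (g : E N → ℝ) (u : Fin N → L2 d) (x : E d) : ℝ :=
  ∫ y, K (x - y) * g (evalVec u y)

/-- `(-Δ + Δ²) uₘ = fₘ` for every `m`. -/
def SolvesPoisson {d N : ℕ} (f : Fin N → E d → ℝ) (u : Fin N → L2 d) : Prop :=
  ∀ m, SolvesLinear (f m) (u m)

/-- The auxiliary system, for `u` with `v` given:
`(-Δ + Δ²) uₘ(x) = εₘ ∫ Hₘ(x - y) gₘ(u₀(y) + v(y)) dy` for every `m`. -/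
def SolvesAux {d N : ℕ} (ε : Fin N → ℝ) (H : Fin N → E d → ℝ) (g : Fin N → E N → ℝ)
    (u₀ v u : Fin N → L2 d) : Prop :=
  ∀ m, SolvesLinear (fun x => ε m * integralTerm (H m) (g m) (u₀ + v) x) (u m)

/-- The perturbed system:
`(-Δ + Δ²) uₘ(x) = εₘ ∫ Hₘ(x - y) gₘ(u₀(y) + u(y)) dy` for every `m`. -/
def SolvesPert {d N : ℕ} (ε : Fin N → ℝ) (H : Fin N → E d → ℝ) (g : Fin N → E N → ℝ)
    (u₀ u : Fin N → L2 d) : Prop :=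
  ∀ m, SolvesLinear (fun x => ε m * integralTerm (H m) (g m) (u₀ + u) x) (u m)

/-- Stationary solutions of the integro-differential system:
`(Δ - Δ²) uₘ(x) + ∫ Kₘ(x - y) gₘ(u(y)) dy + fₘ(x) = 0` for every `m`. -/
def IsStationary {d N : ℕ} (K f : Fin N → E d → ℝ) (g : Fin N → E N → ℝ)
    (u : Fin N → L2 d) : Prop :=
  ∀ m, ∃ w : L2 d,
    (w : E d → ℝ) =ᵐ[volume] (fun x => integralTerm (K m) (g m) u x + f m x) ∧
      (Δ (toDist (u m)) - Δ (Δ (toDist (u m)))) + toDist w = 0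

/-- The `L^p` norm of a function, as a real number (used for functions in `L^p`). -/
def lpNormReal {d : ℕ} (p : ENNReal) (h : E d → ℝ) : ℝ := (eLpNorm h p volume).toReal

/-- `H² = ∑ₘ ‖Hₘ‖²_{L¹}`. -/
def sumSqL1 {d N : ℕ} (H : Fin N → E d → ℝ) : ℝ := ∑ m, lpNormReal 1 (H m) ^ 2

/-- `Q² = ∑ₘ ‖Hₘ‖²_{L²}`. -/
def sumSqL2 {d N : ℕ} (H : Fin N → E d → ℝ) : ℝ := ∑ m, lpNormReal 2 (H m) ^ 2

/-- Assumptions on the influx terms `fₘ` and on the kernels `Hₘ`. -/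
structure DataAssumption {d N : ℕ} (f H : Fin N → E d → ℝ) : Prop where
  f_nontrivial : ∃ m, ¬ f m =ᵐ[volume] 0
  f_L1 : ∀ m, MemLp (f m) 1 volume
  f_L2 : ∀ m, MemLp (f m) 2 volume
  H_L1 : ∀ m, MemLp (H m) 1 volume
  H_L2 : ∀ m, MemLp (H m) 2 volume
  H_pos : 0 < sumSqL1 H
  Q_pos : 0 < sumSqL2 H

/-- The closed ball `I = {z ∈ ℝ^N : |z| ≤ c ‖u₀‖_{H⁴} + c}`. -/
def ballI {d N : ℕ} (c : ℝ) (u₀ : Fin N → L2 d) : Set (E N) :=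
  Metric.closedBall 0 (c * h4NormVec u₀ + c)

/-- The norm `‖h‖_{C(I)} = max_{z ∈ I} |h(z)|` (for `h` continuous on the compact set `I`). -/
def cNorm {N : ℕ} (I : Set (E N)) (h : E N → ℝ) : ℝ := sSup ((fun z => |h z|) '' I)

/-- The partial derivative `∂h/∂zₙ` on the closed ball `I` (up to the boundary). -/
def partialOn {N : ℕ} (I : Set (E N)) (n : Fin N) (h : E N → ℝ) (z : E N) : ℝ :=
  fderivWithin ℝ h I z (EuclideanSpace.single n 1)

/-- `‖h‖_{C²(I)} = ‖h‖_{C(I)} + ∑ₙ ‖∂ₙh‖_{C(I)} + ∑ₙₗ ‖∂ₙ∂ₗh‖_{C(I)}`. -/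
def c2Norm {N : ℕ} (I : Set (E N)) (h : E N → ℝ) : ℝ :=
  cNorm I h + ∑ n, cNorm I (partialOn I n h)
    + ∑ n, ∑ l, cNorm I (partialOn I n (partialOn I l h))

/-- `‖g‖_{C²(I, ℝ^N)} = ∑ₘ ‖gₘ‖_{C²(I)}`. -/
def c2NormVec {N : ℕ} (I : Set (E N)) (g : Fin N → E N → ℝ) : ℝ := ∑ m, c2Norm I (g m)

/-- Assumptions on the nonlinearity `g`, relative to the closed ball `I` and to `M > 0`. -/
structure NonlinAssumption {N : ℕ} (I : Set (E N)) (M : ℝ) (g : Fin N → E N → ℝ) : Prop where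
  zero : ∀ m, g m 0 = 0
  grad_zero : ∀ m, HasGradientAt (g m) 0 0
  M_pos : 0 < M
  contDiffOn : ∀ m, ContDiffOn ℝ 2 (g m) I
  norm_le : c2NormVec I g ≤ M
  nontrivial : ∃ z ∈ I, ∃ m, g m z ≠ 0

/-- The surface measure `|S^d|` of the unit sphere of `ℝ^d`. -/
def sphereArea (d : ℕ) : ℝ := (volume : Measure (E d)).toSphere.real Set.univ

/-- The explicit upper bound for `ε`, as a function of `ρ`, `M`, `A = ‖u₀‖_{H⁴} + 1`,
`H²` and `Q²`. -/
def epsBound (d : ℕ) (ρ M A H2 Q2 : ℝ) : ℝ :=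
  ρ / (M * A ^ 2) *
    (H2 * A ^ ((8 : ℝ) / d - 2) * (sphereArea d / 4) ^ ((4 : ℝ) / d)
        * (d / ((d - 4) * (2 * Real.pi) ^ 4)) + Q2) ^ (-(1 / 2) : ℝ)

end BiLaplace

end

/-! The fixed point problem is solved by contraction, and the work lies in a sharp estimate for the
linear equation. On the Fourier side `-Δ + Δ²` is multiplication by s + s² with s = (2π|ξ|)², which
vanishes only at ξ = 0. A solution u of the equation with right-hand side w therefore satisfies |û|²
≤ (2π)⁻⁴ |ξ|⁻⁴ |ŵ|². For |ξ| ≤ R one uses |ŵ| ≤ ‖w‖₁ and the integrability of |ξ|⁻⁴ near 0, which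
holds because d ≥ 5; for |ξ| > R one uses |ξ|⁻⁴ ≤ R⁻⁴ and Plancherel (`memLp_and_integral_le`).
Moreover s² ≤ s + s² gives ‖Δ²u‖ ≤ ‖w‖₂ (`IsPoisson.exists_isBiLap`). Optimising R (`exists_cutoff`)
produces the explicit constant in the bound for ε.

For d ≤ 7 the embedding of H⁴ in L^∞ keeps u₀ + v inside the ball I whenever v is in B_ρ. There
|∇g(z)| ≤ M|z|, because the gradient vanishes at 0 and the second derivatives are bounded. So g(a) -
g(b) has L² norm at most M‖a - b‖ and L¹ norm at most (M/2)(‖a‖ + ‖b‖)‖a - b‖. Young's inequality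
transfers this to the convolutions: `SolvesIntegral.h4NormVec_sub_sq_le`.

Under the assumption on ε the solution map a ↦ U is then Lipschitz with constant ρ/A on the H⁴ ball
of radius A. Comparison with a = 0 shows that B_ρ is mapped into itself. Since f is nontrivial, u₀ ≠
0, so A > 1 ≥ ρ and the map is a strict contraction. B_ρ is complete because Δ² has closed graph in
L² × L² (`isClosed_graphMap_ball`), and Banach's theorem applies. -/

namespace BiLaplace

/-! ### Young's inequality for convolutions -/

section Young

variable {G : Type*} [NormedAddCommGroup G] [MeasurableSpace G] [BorelSpace G]
  [SecondCountableTopology G] {μ : Measure G} [SFinite μ] [μ.IsAddHaarMeasure]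
  [μ.IsNegInvariant]

set_option linter.unusedSectionVars false

/-- Cauchy–Schwarz for the measure with density `a`. -/
theorem lintegral_mul_sq_le {α : Type*} [MeasurableSpace α] {ν : Measure α} {a b : α → ENNReal}
    (ha : AEMeasurable a ν) (hb : AEMeasurable b ν) :
    (∫⁻ x, a x * b x ∂ν) ^ 2 ≤ (∫⁻ x, a x ∂ν) * ∫⁻ x, a x * b x ^ 2 ∂ν := by
  -- Hölder for the factorisation a b = a^{1/2} · (a^{1/2} b).
  have h := ENNReal.lintegral_mul_le_Lp_mul_Lq ν (Real.HolderConjugate.two_two)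
    (f := fun x => a x ^ (1 / 2 : ℝ)) (g := fun x => a x ^ (1 / 2 : ℝ) * b x)
    (ha.pow_const _) ((ha.pow_const _).mul hb)
  have e1 : ∀ x, a x ^ (1 / 2 : ℝ) * (a x ^ (1 / 2 : ℝ) * b x) = a x * b x := by
    intro x
    rw [← mul_assoc, ← ENNReal.rpow_add_of_nonneg _ _ (by norm_num) (by norm_num)]
    norm_num
  have e2 : ∀ x, (a x ^ (1 / 2 : ℝ)) ^ (2 : ℝ) = a x := by
    intro x
    rw [← ENNReal.rpow_mul]
    norm_num
  have e3 : ∀ x, (a x ^ (1 / 2 : ℝ) * b x) ^ (2 : ℝ) = a x * b x ^ 2 := by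
    intro x
    rw [ENNReal.mul_rpow_of_nonneg _ _ (by norm_num), e2]
    norm_num
  simp only [Pi.mul_apply, e1, e2, e3] at h
  calc (∫⁻ x, a x * b x ∂ν) ^ 2
      ≤ ((∫⁻ x, a x ∂ν) ^ (1 / 2 : ℝ) * (∫⁻ x, a x * b x ^ 2 ∂ν) ^ (1 / 2 : ℝ)) ^ 2 := by gcongr
    _ = _ := by
      rw [mul_pow, ← ENNReal.rpow_mul_natCast, ← ENNReal.rpow_mul_natCast]
      norm_num

theorem eLpNorm_two_sq {α : Type*} {_ : MeasurableSpace α} {ν : Measure α} {F : Type*}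
    [NormedAddCommGroup F] (f : α → F) : eLpNorm f 2 ν ^ 2 = ∫⁻ x, ‖f x‖ₑ ^ 2 ∂ν := by
  have := eLpNorm_nnreal_pow_eq_lintegral (f := f) (μ := ν) (p := 2) (by norm_num)
  norm_num at this
  exact_mod_cast this

theorem aemeasurable_sub_prod {f g : G → ℝ} (hf : AEStronglyMeasurable f μ)
    (hg : AEStronglyMeasurable g μ) (k : ℕ) :
    AEMeasurable (fun p : G × G => ‖f p.2‖ₑ * ‖g (p.1 - p.2)‖ₑ ^ k) (μ.prod μ) := by
  have h1 : AEMeasurable (fun p : G × G => ‖f p.2‖ₑ) (μ.prod μ) :=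
    hf.enorm.comp_quasiMeasurePreserving Measure.quasiMeasurePreserving_snd
  have h2 : AEMeasurable (fun p : G × G => ‖g (p.1 - p.2)‖ₑ) (μ.prod μ) :=
    hg.enorm.comp_quasiMeasurePreserving (quasiMeasurePreserving_sub_of_right_invariant μ μ)
  exact h1.mul (h2.pow_const k)

/-- Tonelli and translation invariance. The exponent k = 1 serves the L¹ form of Young's inequality,
and k = 2 the L² form after Cauchy–Schwarz with weight |f|. -/
theorem lintegral_lintegral_mul_sub {f g : G → ℝ} (hf : AEStronglyMeasurable f μ)
    (hg : AEStronglyMeasurable g μ) (k : ℕ) :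
    ∫⁻ x, ∫⁻ t, ‖f t‖ₑ * ‖g (x - t)‖ₑ ^ k ∂μ ∂μ
      = (∫⁻ t, ‖f t‖ₑ ∂μ) * ∫⁻ x, ‖g x‖ₑ ^ k ∂μ := by
  rw [lintegral_lintegral_swap (aemeasurable_sub_prod hf hg k), ← lintegral_mul_const'' _ hf.enorm]
  congr 1
  ext t
  have h2 : AEMeasurable (fun x => ‖g (x - t)‖ₑ ^ k) μ :=
    (hg.enorm.comp_quasiMeasurePreserving
      (measurePreserving_sub_right μ t).quasiMeasurePreserving).pow_const k
  rw [lintegral_const_mul'' _ h2, lintegral_sub_right_eq_self (fun x => ‖g x‖ₑ ^ k) t]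

/-- Young's inequality `‖f ⋆ g‖₁ ≤ ‖f‖₁ ‖g‖₁`. -/
theorem eLpNorm_one_conv_le {f g : G → ℝ} (hf : AEStronglyMeasurable f μ)
    (hg : AEStronglyMeasurable g μ) :
    eLpNorm (fun x => ∫ t, f t * g (x - t) ∂μ) 1 μ ≤ eLpNorm f 1 μ * eLpNorm g 1 μ := by
  simp only [eLpNorm_one_eq_lintegral_enorm]
  calc ∫⁻ x, ‖∫ t, f t * g (x - t) ∂μ‖ₑ ∂μ
      ≤ ∫⁻ x, ∫⁻ t, ‖f t‖ₑ * ‖g (x - t)‖ₑ ^ 1 ∂μ ∂μ := by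
        refine lintegral_mono fun x => (enorm_integral_le_lintegral_enorm _).trans_eq ?_
        simp [enorm_mul]
    _ = _ := by
        rw [lintegral_lintegral_mul_sub hf hg]
        simp

/-- Young's inequality `‖f ⋆ g‖₂ ≤ ‖f‖₁ ‖g‖₂`. -/
theorem eLpNorm_two_conv_le {f g : G → ℝ} (hf : AEStronglyMeasurable f μ)
    (hg : AEStronglyMeasurable g μ) :
    eLpNorm (fun x => ∫ t, f t * g (x - t) ∂μ) 2 μ ≤ eLpNorm f 1 μ * eLpNorm g 2 μ := by
  rw [← ENNReal.pow_le_pow_left_iff (n := 2) (by norm_num), mul_pow, eLpNorm_two_sq,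
    eLpNorm_two_sq, eLpNorm_one_eq_lintegral_enorm]
  have hx : ∀ x, AEMeasurable (fun t => ‖g (x - t)‖ₑ) μ := fun x =>
    hg.enorm.comp_quasiMeasurePreserving
      (μ.measurePreserving_sub_left x).quasiMeasurePreserving
  calc ∫⁻ x, ‖∫ t, f t * g (x - t) ∂μ‖ₑ ^ 2 ∂μ
      ≤ ∫⁻ x, (∫⁻ t, ‖f t‖ₑ ∂μ) * ∫⁻ t, ‖f t‖ₑ * ‖g (x - t)‖ₑ ^ 2 ∂μ ∂μ := by
        refine lintegral_mono fun x => le_trans ?_ (lintegral_mul_sq_le hf.enorm (hx x))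
        gcongr
        refine (enorm_integral_le_lintegral_enorm _).trans_eq ?_
        simp [enorm_mul]
    _ = _ := by
        rw [lintegral_const_mul'' _
          (aemeasurable_sub_prod hf hg 2).lintegral_prod_right', lintegral_lintegral_mul_sub hf hg]
        ring

/-- The convolution integral in the two orders of the factors. -/
theorem integral_sub_mul_eq (f g : G → ℝ) (x : G) :
    ∫ y, g (x - y) * f y ∂μ = ∫ t, g t * f (x - t) ∂μ := by
  rw [← integral_sub_left_eq_self (fun t => g t * f (x - t)) μ x]
  simp

theorem aestronglyMeasurable_conv {f g : G → ℝ} (hf : Integrable f μ) (hg : Integrable g μ) :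
    AEStronglyMeasurable (fun x => ∫ y, g (x - y) * f y ∂μ) μ := by
  have h := (Integrable.integrable_convolution (ContinuousLinearMap.mul ℝ ℝ) hf hg).1
  refine h.congr (Filter.Eventually.of_forall fun x => ?_)
  simp [convolution_def, mul_comm]

theorem integrable_sub_mul {f g : G → ℝ} (hf : MemLp f 2 μ) (hg : MemLp g 2 μ) (x : G) :
    Integrable (fun y => g (x - y) * f y) μ := by
  have : MemLp (fun y => g (x - y)) 2 μ :=
    hg.comp_measurePreserving (μ.measurePreserving_sub_left x)
  exact this.integrable_mul hf

end Young

/-! ### Fourier transform of L² functions and of tempered distributions -/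

section Fourier

open FourierTransform TemperedDistribution
open scoped ContDiff

variable {d : ℕ}

/-- The complex Hilbert space `L²(ℝ^d)`. -/
abbrev L2C (d : ℕ) : Type := Lp ℂ 2 (volume : Measure (E d))

/-- Smooth compactly supported real test functions already separate locally integrable functions.
The pairing is only required for ψ with integrable products, since for other ψ the integrals carry
no information. -/
theorem ae_eq_of_forall_schwartz {f g : E d → ℂ} (hf : LocallyIntegrable f)
    (hg : LocallyIntegrable g)
    (h : ∀ ψ : 𝓢(E d, ℂ), Integrable (fun x => ψ x * f x) → Integrable (fun x => ψ x * g x) →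
      ∫ x, ψ x * f x = ∫ x, ψ x * g x) : f =ᵐ[volume] g := by
  have h0 : ∀ᵐ x, f x - g x = 0 := by
    refine ae_eq_zero_of_integral_contDiff_smul_eq_zero (hf.sub hg) fun φ φ_smooth φ_cpt => ?_
    have hc : HasCompactSupport (Complex.ofRealCLM ∘ φ) := φ_cpt.comp_left rfl
    have hs : ContDiff ℝ ∞ (Complex.ofRealCLM ∘ φ) := by fun_prop
    have hif := hf.integrable_smul_left_of_hasCompactSupport φ_smooth.continuous φ_cpt
    have hig := hg.integrable_smul_left_of_hasCompactSupport φ_smooth.continuous φ_cpt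
    have := h (hc.toSchwartzMap hs) (by simpa using hif) (by simpa using hig)
    simp only [smul_sub]
    rw [integral_sub hif hig, sub_eq_zero]
    simpa using this
  filter_upwards [h0] with x hx using sub_eq_zero.mp hx

theorem locallyIntegrable_mul_of_continuous {p : E d → ℂ} (hp : Continuous p) (F : L2C d) :
    LocallyIntegrable fun x => p x * (F : E d → ℂ) x := by
  have h := (Lp.memLp F).locallyIntegrable (by norm_num)
  exact locallyIntegrableOn_univ.1 ((h.locallyIntegrableOn Set.univ).continuousOn_mul
    hp.continuousOn isOpen_univ.isLocallyClosed)

/-- Multiplication of an `L²` function by a symbol, in the sense of tempered distributions and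
almost everywhere. -/
theorem smulLeftCLM_eq_iff {p : E d → ℂ} (hp : p.HasTemperateGrowth) (F G : L2C d) :
    smulLeftCLM ℂ p (F : 𝓢'(E d, ℂ)) = (G : 𝓢'(E d, ℂ)) ↔
      (fun x => p x * (F : E d → ℂ) x) =ᵐ[volume] G := by
  have key : ∀ ψ : 𝓢(E d, ℂ), smulLeftCLM ℂ p (F : 𝓢'(E d, ℂ)) ψ
      = ∫ x, ψ x * (p x * (F : E d → ℂ) x) := by
    intro ψ
    simp [Lp.toTemperedDistribution_apply, SchwartzMap.smulLeftCLM_apply_apply hp, mul_left_comm,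
      mul_assoc]
  constructor
  · intro h
    refine ae_eq_of_forall_schwartz (locallyIntegrable_mul_of_continuous hp.1.continuous F)
      ((Lp.memLp G).locallyIntegrable (by norm_num)) fun ψ _ _ => ?_
    rw [← key, h]
    simp [Lp.toTemperedDistribution_apply]
  · intro h
    ext ψ
    rw [key]
    simp only [Lp.toTemperedDistribution_apply, smul_eq_mul]
    refine integral_congr_ae ?_
    filter_upwards [h] with x hx
    rw [hx]

/-- The symbol of `-Δ`. -/
noncomputable def symbol (ξ : E d) : ℝ := (2 * Real.pi * ‖ξ‖) ^ 2

theorem symbol_nonneg (ξ : E d) : 0 ≤ symbol ξ := sq_nonneg _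

theorem symbol_temperate :
    (fun ξ : E d => (symbol ξ : ℂ)).HasTemperateGrowth := by
  unfold symbol
  simp only [mul_pow]
  fun_prop

theorem symbol_sq_temperate :
    (fun ξ : E d => ((symbol ξ ^ 2 : ℝ) : ℂ)).HasTemperateGrowth := by
  unfold symbol
  simp only [mul_pow]
  fun_prop

theorem fourier_laplacian (T : 𝓢'(E d, ℂ)) :
    𝓕 (Δ T) = - smulLeftCLM ℂ (fun ξ : E d => (symbol ξ : ℂ)) (𝓕 T) := by
  rw [laplacian_eq_fourierMultiplierCLM, fourierMultiplierCLM_apply]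
  have : (fun ξ : E d => (symbol ξ : ℂ)) = ((2 * Real.pi) ^ 2 : ℂ) • fun ξ : E d =>
      ((‖ξ‖ ^ 2 : ℝ) : ℂ) := by
    ext ξ
    simp [symbol, mul_pow]
  rw [this, smulLeftCLM_smul (by fun_prop)]
  ext ψ
  simp

theorem fourier_biLaplacian (T : 𝓢'(E d, ℂ)) :
    𝓕 (Δ (Δ T)) = smulLeftCLM ℂ (fun ξ : E d => ((symbol ξ ^ 2 : ℝ) : ℂ)) (𝓕 T) := by
  rw [fourier_laplacian, fourier_laplacian, map_neg, neg_neg,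
    smulLeftCLM_smulLeftCLM_apply symbol_temperate symbol_temperate]
  congr 2
  ext ξ
  simp [sq]

theorem fourier_toTempered_injective :
    Function.Injective (fun T : 𝓢'(E d, ℂ) => 𝓕 T) := fun S T h => by
  simpa using congrArg (fun T : 𝓢'(E d, ℂ) => 𝓕⁻ T) h

/-- The Fourier transform is injective on tempered distributions and agrees there with the L²
transform, so a distributional identity between L² functions becomes an a.e. identity between
multipliers. -/
theorem biLaplacian_eq_iff (U W : L2C d) :
    Δ (Δ (U : 𝓢'(E d, ℂ))) = (W : 𝓢'(E d, ℂ)) ↔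
      (fun ξ => ((symbol ξ ^ 2 : ℝ) : ℂ) * (𝓕 U : L2C d) ξ) =ᵐ[volume] (𝓕 W : L2C d) := by
  have hp := symbol_sq_temperate (d := d)
  rw [← smulLeftCLM_eq_iff hp, ← Lp.fourier_toTemperedDistribution_eq,
    ← Lp.fourier_toTemperedDistribution_eq, ← fourier_biLaplacian,
    fourier_toTempered_injective.eq_iff]

theorem poisson_eq_iff (U W : L2C d) :
    -Δ (U : 𝓢'(E d, ℂ)) + Δ (Δ (U : 𝓢'(E d, ℂ))) = (W : 𝓢'(E d, ℂ)) ↔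
      (fun ξ => ((symbol ξ + symbol ξ ^ 2 : ℝ) : ℂ) * (𝓕 U : L2C d) ξ)
        =ᵐ[volume] (𝓕 W : L2C d) := by
  have hp := symbol_sq_temperate (d := d)
  have hsum : (fun ξ : E d => ((symbol ξ + symbol ξ ^ 2 : ℝ) : ℂ))
      = (fun ξ : E d => (symbol ξ : ℂ)) + fun ξ : E d => ((symbol ξ ^ 2 : ℝ) : ℂ) := by
    ext ξ
    simp
  have hps : (fun ξ : E d => ((symbol ξ + symbol ξ ^ 2 : ℝ) : ℂ)).HasTemperateGrowth := by
    rw [hsum]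
    exact symbol_temperate.add hp
  rw [← smulLeftCLM_eq_iff hps, ← Lp.fourier_toTemperedDistribution_eq,
    ← Lp.fourier_toTemperedDistribution_eq, hsum, smulLeftCLM_add symbol_temperate hp,
    add_apply, ← fourier_biLaplacian,
    ← neg_neg (smulLeftCLM ℂ (fun ξ : E d => (symbol ξ : ℂ)) _), ← fourier_laplacian,
    ← FourierTransform.fourier_neg, ← FourierTransform.fourier_add,
    fourier_toTempered_injective.eq_iff]

theorem integral_fourier_mul_eq_of_integrable (ψ : 𝓢(E d, ℂ)) {f : E d → ℂ} (hf : Integrable f) :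
    ∫ x, (𝓕 ψ) x * f x = ∫ x, ψ x * 𝓕 f x := by
  simpa using! VectorFourier.integral_bilin_fourierIntegral_eq_flip (.mul ℂ ℂ) (L := innerₗ (E d))
    Real.continuous_fourierChar continuous_inner ψ.integrable hf

/-- The pairing identifies A with the classical Fourier integral of f, which is bounded by the L¹
norm. It serves both for the transform of an L¹ function and, in the other direction, for Fourier
inversion. -/
theorem ae_norm_le_integral_norm_of_pairing (A : L2C d) {f : E d → ℂ} (hf : Integrable f)
    (h : ∀ ψ : 𝓢(E d, ℂ), ∫ x, ψ x * (A : E d → ℂ) x = ∫ x, (𝓕 ψ) x * f x) :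
    ∀ᵐ ξ, ‖(A : E d → ℂ) ξ‖ ≤ ∫ x, ‖f x‖ := by
  have hc : Continuous (𝓕 f) := VectorFourier.fourierIntegral_continuous
    Real.continuous_fourierChar (L := innerₗ (E d)) continuous_inner hf
  have : (A : E d → ℂ) =ᵐ[volume] 𝓕 f := by
    refine ae_eq_of_forall_schwartz ((Lp.memLp A).locallyIntegrable (by norm_num))
      hc.locallyIntegrable fun ψ _ _ => ?_
    rw [h, integral_fourier_mul_eq_of_integrable ψ hf]
  filter_upwards [this] with ξ hξ
  rw [hξ]
  exact VectorFourier.norm_fourierIntegral_le_integral_norm _ _ _ _ _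

/-- The `L²` Fourier transform of an integrable function is bounded by its `L¹` norm. -/
theorem ae_norm_fourier_le (W : L2C d) (hW : Integrable (W : E d → ℂ)) :
    ∀ᵐ ξ, ‖(𝓕 W : L2C d) ξ‖ ≤ ∫ x, ‖(W : E d → ℂ) x‖ := by
  refine ae_norm_le_integral_norm_of_pairing (𝓕 W) hW fun ψ => ?_
  have := congrArg (fun T : 𝓢'(E d, ℂ) => T ψ) (Lp.fourier_toTemperedDistribution_eq W)
  simpa [Lp.toTemperedDistribution_apply] using this.symm

/-- A function with integrable Fourier transform is bounded by the `L¹` norm of the latter. -/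
theorem ae_norm_le_integral_fourier (U : L2C d) (hU : Integrable (𝓕 U : L2C d)) :
    ∀ᵐ x, ‖(U : E d → ℂ) x‖ ≤ ∫ ξ, ‖(𝓕 U : L2C d) ξ‖ := by
  -- Reflecting the transform turns the inverse Fourier integral into a forward one.
  have key := ae_norm_le_integral_norm_of_pairing U hU.comp_neg fun ψ => ?_
  · rwa [integral_neg_eq_self (fun ξ => ‖(𝓕 U : L2C d) ξ‖)] at key
  have : (U : 𝓢'(E d, ℂ)) (𝓕 (𝓕⁻ ψ)) = _ :=
    congrArg (fun T : 𝓢'(E d, ℂ) => T (𝓕⁻ ψ)) (Lp.fourier_toTemperedDistribution_eq U)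
  simp only [Lp.toTemperedDistribution_apply, smul_eq_mul,
    FourierTransform.fourier_fourierInv_eq] at this
  rw [this, ← integral_neg_eq_self]
  refine integral_congr_ae (Filter.Eventually.of_forall fun x => ?_)
  simp [SchwartzMap.fourierInv_coe, Real.fourierInv_eq_fourier_neg, SchwartzMap.fourier_coe]

end Fourier

/-! ### Passing from complex solutions to real ones -/

section RealPart

open TemperedDistribution
open scoped ComplexConjugate

variable {d : ℕ}

/-- Complex conjugation on Schwartz functions. -/
noncomputable def conjSchwartz : 𝓢(E d, ℂ) →L[ℝ] 𝓢(E d, ℂ) :=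
  SchwartzMap.postcompCLM (Complex.conjCLE : ℂ →L[ℝ] ℂ)

theorem conjSchwartz_apply (ψ : 𝓢(E d, ℂ)) (x : E d) : conjSchwartz ψ x = conj (ψ x) := rfl

theorem laplacian_conjSchwartz (ψ : 𝓢(E d, ℂ)) : Δ (conjSchwartz ψ) = conjSchwartz (Δ ψ) := by
  ext x
  rw [conjSchwartz_apply, SchwartzMap.laplacian_apply, SchwartzMap.laplacian_apply]
  exact ContDiffAt.laplacian_CLM_comp_left (l := (Complex.conjCLE : ℂ →L[ℝ] ℂ))
    ((ψ.smooth 2).contDiffAt)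

/-- `S` is the real part of the distribution `T`. -/
def IsRealPart (T S : 𝓢'(E d, ℂ)) : Prop :=
  ∀ ψ, S ψ = (T ψ + conj (T (conjSchwartz ψ))) / 2

/-- Δ has real coefficients, so it commutes with conjugation of test functions. This lets a complex
solution built by Fourier inversion be replaced by its real part. -/
theorem IsRealPart.laplacian {T S : 𝓢'(E d, ℂ)} (h : IsRealPart T S) :
    IsRealPart (Δ T) (Δ S) := fun ψ => by
  simp [laplacian_apply_apply, h (Δ ψ), laplacian_conjSchwartz]

theorem IsRealPart.neg_add {T S T' S' : 𝓢'(E d, ℂ)} (h : IsRealPart T S)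
    (h' : IsRealPart T' S') : IsRealPart (-T + T') (-S + S') := fun ψ => by
  simp [h ψ, h' ψ]
  ring

theorem IsRealPart.unique {T S S' : 𝓢'(E d, ℂ)} (h : IsRealPart T S) (h' : IsRealPart T S') :
    S = S' := by
  ext ψ
  rw [h ψ, h' ψ]

/-- The real part of a complex `L²` function. -/
noncomputable def rePart (U : L2C d) : L2 d := Complex.reCLM.compLp U

theorem isRealPart_rePart (U : L2C d) :
    IsRealPart (U : 𝓢'(E d, ℂ)) (toDist (rePart U)) := fun ψ => by
  have h1 := Complex.ofRealCLM.coeFn_compLp (rePart U)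
  have h2 := Complex.reCLM.coeFn_compLp U
  have hi : ∀ φ : 𝓢(E d, ℂ), Integrable fun x => φ x * (U : E d → ℂ) x := fun φ =>
    (φ.memLp 2 volume).integrable_mul (Lp.memLp U)
  have hc : Integrable fun x => conj (conjSchwartz ψ x * (U : E d → ℂ) x) :=
    (Complex.conjCLE : ℂ →L[ℝ] ℂ).integrable_comp (hi (conjSchwartz ψ))
  simp only [toDist, Lp.toTemperedDistribution_apply, smul_eq_mul]
  rw [← integral_conj, ← integral_add (hi ψ) hc, ← integral_div]
  refine integral_congr_ae ?_
  filter_upwards [h1, h2] with x hx1 hx2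
  have hx2' : (rePart U : E d → ℝ) x = ((U : E d → ℂ) x).re := hx2
  rw [hx1, hx2', conjSchwartz_apply, map_mul, Complex.conj_conj, ← mul_add,
    Complex.add_conj]
  simp
  ring

theorem rePart_ofReal (φ : L2 d) :
    rePart (Complex.ofRealCLM.compLp φ : L2C d) = φ := by
  apply Lp.ext
  filter_upwards [Complex.reCLM.coeFn_compLp (Complex.ofRealCLM.compLp φ : L2C d),
    Complex.ofRealCLM.coeFn_compLp φ] with x h1 h2
  have h1' : (rePart (Complex.ofRealCLM.compLp φ : L2C d) : E d → ℝ) x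
    = Complex.reCLM ((Complex.ofRealCLM.compLp φ : L2C d) x) := h1
  rw [h1', h2]
  simp

end RealPart

/-! ### The linear equation, its estimates, and the Sobolev embedding -/

section Linear

open FourierTransform TemperedDistribution

variable {d : ℕ}

/-- A real `L²` function as a complex one. -/
noncomputable def toComplex (φ : L2 d) : L2C d := Complex.ofRealCLM.compLp φ

theorem toComplex_ae (φ : L2 d) :
    (toComplex φ : E d → ℂ) =ᵐ[volume] fun x => (((φ : E d → ℝ) x : ℝ) : ℂ) :=
  Complex.ofRealCLM.coeFn_compLp φ

theorem norm_toComplex (φ : L2 d) : ‖toComplex φ‖ = ‖φ‖ := by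
  rw [Lp.norm_def, Lp.norm_def]
  congr 1
  refine eLpNorm_congr_norm_ae ?_
  filter_upwards [toComplex_ae φ] with x hx
  rw [hx, Complex.norm_real]

theorem norm_rePart_le (U : L2C d) : ‖rePart U‖ ≤ ‖U‖ := by
  refine (Complex.reCLM.norm_compLp_le U).trans ?_
  simp

/-- The Fourier transform of a real `L²` function. -/
noncomputable def fhat (φ : L2 d) : L2C d := 𝓕 (toComplex φ)

theorem norm_fhat (φ : L2 d) : ‖fhat φ‖ = ‖φ‖ :=
  (Lp.norm_fourier_eq _).trans (norm_toComplex φ)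

theorem isBiLap_iff (φ w : L2 d) :
    IsBiLap φ w ↔
      (fun ξ => ((symbol ξ ^ 2 : ℝ) : ℂ) * fhat φ ξ) =ᵐ[volume] fhat w :=
  biLaplacian_eq_iff (toComplex φ) (toComplex w)

/-- `(-Δ + Δ²) u = w` in the sense of distributions. -/
def IsPoisson (u w : L2 d) : Prop := -Δ (toDist u) + Δ (Δ (toDist u)) = toDist w

theorem isPoisson_iff (u w : L2 d) :
    IsPoisson u w ↔
      (fun ξ => ((symbol ξ + symbol ξ ^ 2 : ℝ) : ℂ) * fhat u ξ) =ᵐ[volume] fhat w :=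
  poisson_eq_iff (toComplex u) (toComplex w)

theorem Lp_two_norm_sq {α F : Type*} {_ : MeasurableSpace α} {ν : Measure α}
    [NormedAddCommGroup F] (f : Lp F 2 ν) : ‖f‖ ^ 2 = ∫ x, ‖f x‖ ^ 2 ∂ν := by
  rw [Lp.norm_def, ← ENNReal.toReal_pow, eLpNorm_two_sq, integral_eq_lintegral_of_nonneg_ae
    (f := fun x => ‖f x‖ ^ 2) (Filter.Eventually.of_forall fun x => by positivity) ((Lp.aestronglyMeasurable f).norm.pow 2)]
  congr 1
  refine lintegral_congr fun x => ?_
  rw [ENNReal.ofReal_pow (norm_nonneg _), ofReal_norm]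

/-- In polar coordinates the integrand is r^{d-1} r⁻⁴ = r^{d-5} on (0, R], bounded exactly because d
≥ 5. -/
theorem integrable_radial (hd : 5 ≤ d) (R : ℝ) :
    Integrable (fun ξ : E d => (Set.Iic R).indicator (fun r => (r ^ 4)⁻¹) ‖ξ‖) := by
  have : Nonempty (Fin d) := ⟨⟨0, by omega⟩⟩
  rw [integrable_fun_norm_addHaar volume (f := (Set.Iic R).indicator (fun r => (r ^ 4)⁻¹))]
  have h : IntegrableOn (fun y : ℝ => y ^ (d - 5)) (Set.Ioc 0 R) :=
    ((continuous_pow _).integrableOn_Icc).mono_set Set.Ioc_subset_Icc_self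
  have h' : IntegrableOn ((Set.Ioc 0 R).indicator fun y : ℝ => y ^ (d - 5)) (Set.Ioi 0) :=
    (h.integrable_indicator measurableSet_Ioc).integrableOn
  refine h'.congr_fun (fun y hy => ?_) measurableSet_Ioi
  have hy0 : (0 : ℝ) < y := hy
  obtain ⟨k, rfl⟩ := Nat.exists_eq_add_of_le hd
  by_cases hyR : y ≤ R
  · simp [Set.indicator, hyR, hy0, show 5 + k - 1 = k + 4 by omega, pow_add]
    field_simp
  · simp [Set.indicator, hyR]

theorem integral_radial (hd : 5 ≤ d) {R : ℝ} (hR : 0 < R) :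
    ∫ ξ : E d, (Set.Iic R).indicator (fun r => (r ^ 4)⁻¹) ‖ξ‖
      = sphereArea d * (R ^ (d - 4) / (d - 4)) := by
  have : Nonempty (Fin d) := ⟨⟨0, by omega⟩⟩
  rw [integral_fun_norm_addHaar volume (f := (Set.Iic R).indicator (fun r => (r ^ 4)⁻¹)),
    sphereArea, Measure.toSphere_real_apply_univ]
  have h : ∫ y in Set.Ioi (0 : ℝ), y ^ (Module.finrank ℝ (E d) - 1) •
      (Set.Iic R).indicator (fun r => (r ^ 4)⁻¹) y = R ^ (d - 4) / (d - 4) := by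
    have e : ∀ y ∈ Set.Ioi (0 : ℝ), y ^ (Module.finrank ℝ (E d) - 1) •
        (Set.Iic R).indicator (fun r => (r ^ 4)⁻¹) y
          = (Set.Ioc 0 R).indicator (fun y : ℝ => y ^ (d - 5)) y := by
      intro y hy
      have hy0 : (0 : ℝ) < y := hy
      obtain ⟨k, rfl⟩ := Nat.exists_eq_add_of_le hd
      by_cases hyR : y ≤ R
      · simp [Set.indicator, hyR, hy0, show 5 + k - 1 = k + 4 by omega, pow_add]
        field_simp
      · simp [Set.indicator, hyR]
    rw [setIntegral_congr_fun measurableSet_Ioi e, setIntegral_indicator measurableSet_Ioc,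
      Set.inter_eq_right.mpr Set.Ioc_subset_Ioi_self,
      ← intervalIntegral.integral_of_le hR.le, integral_pow]
    obtain ⟨k, rfl⟩ := Nat.exists_eq_add_of_le hd
    have e1 : 5 + k - 5 = k := by omega
    have e2 : 5 + k - 4 = k + 1 := by omega
    rw [e1, e2]
    push_cast
    congr 1
    · simp
    · ring
  rw [h]
  simp [nsmul_eq_mul, mul_assoc]

theorem symbol_pos {ξ : E d} (h : ξ ≠ 0) : 0 < symbol ξ := by
  have := norm_pos_iff.mpr h
  have := Real.pi_pos
  unfold symbol
  positivity

theorem ae_ne_zero (hd : 5 ≤ d) : ∀ᵐ ξ : E d, ξ ≠ 0 := by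
  have : Nonempty (Fin d) := ⟨⟨0, by omega⟩⟩
  exact Measure.ae_ne volume 0

/-- Dropping s² from s + s² leaves (2π)⁴|ξ|⁴|z|² ≤ |ω|². Inside the ball of radius R one then
inserts |ω| ≤ K, outside it |ξ|⁻⁴ ≤ R⁻⁴; the indicator merges the two cases. -/
theorem sq_norm_le_of_symbol_mul {ξ : E d} (hξ : ξ ≠ 0) {z ω : ℂ} {K R : ℝ} (hR : 0 < R)
    (h : ((symbol ξ + symbol ξ ^ 2 : ℝ) : ℂ) * z = ω) (hK : ‖ω‖ ≤ K) :
    ‖z‖ ^ 2 ≤ ((2 * Real.pi) ^ 4)⁻¹ * (K ^ 2 * (Set.Iic R).indicator (fun r => (r ^ 4)⁻¹) ‖ξ‖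
      + (R ^ 4)⁻¹ * ‖ω‖ ^ 2) := by
  have hs := symbol_pos hξ
  have hn := norm_pos_iff.mpr hξ
  have hpi := Real.pi_pos
  have h1 : (symbol ξ + symbol ξ ^ 2) * ‖z‖ = ‖ω‖ := by
    rw [← h, norm_mul, Complex.norm_real, Real.norm_of_nonneg (by positivity)]
  have h2 : symbol ξ * ‖z‖ ≤ ‖ω‖ := by
    rw [← h1]
    gcongr
    nlinarith [sq_nonneg (symbol ξ)]
  have h3 : symbol ξ ^ 2 * ‖z‖ ^ 2 ≤ ‖ω‖ ^ 2 := by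
    rw [← mul_pow]
    gcongr
  have h4 : symbol ξ ^ 2 = (2 * Real.pi) ^ 4 * ‖ξ‖ ^ 4 := by
    unfold symbol
    ring
  rw [h4] at h3
  rw [inv_mul_eq_div, le_div_iff₀ (by positivity)]
  by_cases hξR : ‖ξ‖ ≤ R
  · rw [Set.indicator_of_mem (by exact hξR)]
    have h5 : ‖z‖ ^ 2 * (2 * Real.pi) ^ 4 ≤ ‖ω‖ ^ 2 * (‖ξ‖ ^ 4)⁻¹ := by
      rw [← div_eq_mul_inv, le_div_iff₀ (by positivity)]
      linarith
    have h6 : ‖ω‖ ^ 2 * (‖ξ‖ ^ 4)⁻¹ ≤ K ^ 2 * (‖ξ‖ ^ 4)⁻¹ := by gcongr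
    have h7 : 0 ≤ (R ^ 4)⁻¹ * ‖ω‖ ^ 2 := by positivity
    linarith
  · rw [Set.indicator_of_notMem (by exact hξR)]
    rw [mul_zero, zero_add, inv_mul_eq_div, le_div_iff₀ (by positivity)]
    have : R ^ 4 ≤ ‖ξ‖ ^ 4 := by
      push Not at hξR
      gcongr
    calc ‖z‖ ^ 2 * (2 * Real.pi) ^ 4 * R ^ 4 ≤ ‖z‖ ^ 2 * (2 * Real.pi) ^ 4 * ‖ξ‖ ^ 4 := by gcongr
      _ ≤ ‖ω‖ ^ 2 := by linarith

/-- The `L²` bound for the Fourier multiplier `(|p|² + |p|⁴)⁻¹` applied to a bounded `L²`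
function: low frequencies `|ξ| ≤ R` are controlled by the supremum, high ones by the `L²` norm. -/
theorem memLp_and_integral_le (hd : 5 ≤ d) {V : E d → ℂ} (hV : AEStronglyMeasurable V)
    (W : L2C d) {K : ℝ} (hK : ∀ᵐ ξ, ‖(W : E d → ℂ) ξ‖ ≤ K)
    (h : (fun ξ => ((symbol ξ + symbol ξ ^ 2 : ℝ) : ℂ) * V ξ) =ᵐ[volume] W) :
    MemLp V 2 ∧ ∀ R : ℝ, 0 < R → ∫ ξ, ‖V ξ‖ ^ 2 ≤
      ((2 * Real.pi) ^ 4)⁻¹ * (K ^ 2 * (sphereArea d * (R ^ (d - 4) / (d - 4)))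
        + (R ^ 4)⁻¹ * ‖W‖ ^ 2) := by
  have hb : ∀ R : ℝ, 0 < R → ∀ᵐ ξ, ‖V ξ‖ ^ 2 ≤ ((2 * Real.pi) ^ 4)⁻¹ *
      (K ^ 2 * (Set.Iic R).indicator (fun r => (r ^ 4)⁻¹) ‖ξ‖
        + (R ^ 4)⁻¹ * ‖(W : E d → ℂ) ξ‖ ^ 2) := by
    intro R hR
    filter_upwards [ae_ne_zero hd, hK, h] with ξ h1 h2 h3
    exact sq_norm_le_of_symbol_mul h1 hR h3 h2
  have hW : Integrable fun ξ => ‖(W : E d → ℂ) ξ‖ ^ 2 := (Lp.memLp W).integrable_norm_pow two_ne_zero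
  have hi : ∀ R : ℝ, Integrable fun ξ : E d => ((2 * Real.pi) ^ 4)⁻¹ *
      (K ^ 2 * (Set.Iic R).indicator (fun r => (r ^ 4)⁻¹) ‖ξ‖
        + (R ^ 4)⁻¹ * ‖(W : E d → ℂ) ξ‖ ^ 2) := fun R =>
    (((integrable_radial hd R).const_mul _).add (hW.const_mul _)).const_mul _
  have hm : Integrable fun ξ => ‖V ξ‖ ^ 2 := by
    refine (hi 1).mono' (hV.norm.pow 2) ?_
    filter_upwards [hb 1 one_pos] with ξ hξ
    rwa [Real.norm_of_nonneg (by positivity)]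
  refine ⟨(memLp_two_iff_integrable_sq_norm hV).mpr hm, fun R hR => ?_⟩
  refine (integral_mono_ae hm (hi R) (hb R hR)).trans_eq ?_
  rw [integral_const_mul, integral_add ((integrable_radial hd R).const_mul _) (hW.const_mul _),
    integral_const_mul, integral_const_mul, integral_radial hd hR, Lp_two_norm_sq]

theorem toDist_eq (φ : L2 d) : toDist φ = (toComplex φ : 𝓢'(E d, ℂ)) := rfl

theorem isRealPart_toDist (φ : L2 d) : IsRealPart (toDist φ) (toDist φ) := by
  have := isRealPart_rePart (toComplex φ)
  rwa [show rePart (toComplex φ) = φ from rePart_ofReal φ] at this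

theorem ae_norm_fhat_le (w : L2 d) (hw : Integrable (w : E d → ℝ)) :
    ∀ᵐ ξ, ‖fhat w ξ‖ ≤ ∫ x, ‖(w : E d → ℝ) x‖ := by
  have h1 : Integrable (toComplex w : E d → ℂ) :=
    (hw.ofReal (𝕜 := ℂ)).congr (toComplex_ae w).symm
  have h2 : ∫ x, ‖(toComplex w : E d → ℂ) x‖ = ∫ x, ‖(w : E d → ℝ) x‖ := by
    refine integral_congr_ae ?_
    filter_upwards [toComplex_ae w] with x hx
    rw [hx, Complex.norm_real]
  rw [← h2]
  exact ae_norm_fourier_le _ h1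

/-- Solvability of `(-Δ + Δ²) u = w` for `w ∈ L¹ ∩ L²`. -/
theorem exists_isPoisson (hd : 5 ≤ d) (w : L2 d) (hw : Integrable (w : E d → ℝ)) :
    ∃ u, IsPoisson u w := by
  -- At ξ = 0 the inverse is 0 by convention; this point is a null set and plays no role.
  let V : E d → ℂ := fun ξ => ((symbol ξ + symbol ξ ^ 2 : ℝ) : ℂ)⁻¹ * fhat w ξ
  have hsym : Continuous fun ξ : E d => ((symbol ξ + symbol ξ ^ 2 : ℝ) : ℂ) := by
    unfold symbol
    fun_prop
  have hVm : AEStronglyMeasurable V :=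
    (hsym.measurable.inv.aestronglyMeasurable).mul (Lp.aestronglyMeasurable _)
  have hV : (fun ξ => ((symbol ξ + symbol ξ ^ 2 : ℝ) : ℂ) * V ξ) =ᵐ[volume] fhat w := by
    filter_upwards [ae_ne_zero hd] with ξ hξ
    have := symbol_pos hξ
    have h0 : ((symbol ξ + symbol ξ ^ 2 : ℝ) : ℂ) ≠ 0 := by
      exact_mod_cast (by positivity : symbol ξ + symbol ξ ^ 2 ≠ 0)
    exact mul_inv_cancel_left₀ h0 _
  have hV2 := (memLp_and_integral_le hd hVm (fhat w) (ae_norm_fhat_le w hw) hV).1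
  let U : L2C d := 𝓕⁻ (hV2.toLp V)
  have hU : -Δ (U : 𝓢'(E d, ℂ)) + Δ (Δ (U : 𝓢'(E d, ℂ))) = toDist w := by
    rw [toDist_eq, poisson_eq_iff]
    filter_upwards [hV, hV2.coeFn_toLp] with ξ h1 h2
    rw [show (𝓕 U : L2C d) = hV2.toLp V from fourier_fourierInv_eq _, h2, h1]
    rfl
  -- U is a priori complex. Since w is real, taking real parts of the equation gives a real
  -- solution.
  refine ⟨rePart U, ?_⟩
  have hr := isRealPart_rePart U
  have h1 := hr.laplacian.neg_add hr.laplacian.laplacian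
  rw [hU] at h1
  exact h1.unique (isRealPart_toDist w)

theorem fhat_injective : Function.Injective (fhat (d := d)) := by
  intro φ ψ h
  refine toDist_injective ?_
  rw [toDist_eq, toDist_eq]
  congr 1
  have := congrArg (fun T : L2C d => 𝓕⁻ T) h
  simpa [fhat] using this

theorem IsPoisson.unique (hd : 5 ≤ d) {u v w : L2 d} (hu : IsPoisson u w) (hv : IsPoisson v w) :
    u = v := by
  rw [isPoisson_iff] at hu hv
  refine fhat_injective (Lp.ext ?_)
  filter_upwards [hu, hv, ae_ne_zero hd] with ξ h1 h2 hξ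
  have := symbol_pos hξ
  have h0 : ((symbol ξ + symbol ξ ^ 2 : ℝ) : ℂ) ≠ 0 := by
    exact_mod_cast (by positivity : symbol ξ + symbol ξ ^ 2 ≠ 0)
  exact mul_left_cancel₀ h0 (h1.trans h2.symm)

/-- Solutions of `(-Δ + Δ²) u = w` are in `H⁴`, with `‖Δ²u‖ ≤ ‖w‖`. -/
theorem IsPoisson.exists_isBiLap {u w : L2 d} (h : IsPoisson u w) :
    ∃ b, IsBiLap u b ∧ ‖b‖ ≤ ‖w‖ := by
  rw [isPoisson_iff] at h
  let V : E d → ℂ := fun ξ => ((symbol ξ ^ 2 : ℝ) : ℂ) * fhat u ξ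
  have hsym : Continuous fun ξ : E d => ((symbol ξ ^ 2 : ℝ) : ℂ) := by
    unfold symbol
    fun_prop
  have hVm : AEStronglyMeasurable V :=
    hsym.aestronglyMeasurable.mul (Lp.aestronglyMeasurable _)
  -- The multiplier s² / (s + s²) is at most 1.
  have hle : ∀ᵐ ξ, ‖V ξ‖ ≤ ‖fhat w ξ‖ := by
    filter_upwards [h] with ξ hξ
    have := symbol_nonneg ξ
    rw [← hξ, norm_mul, norm_mul, Complex.norm_real, Complex.norm_real,
      Real.norm_of_nonneg (by positivity), Real.norm_of_nonneg (by positivity)]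
    gcongr
    linarith
  have hV2 : MemLp V 2 := (Lp.memLp (fhat w)).of_le hVm hle
  let B : L2C d := 𝓕⁻ (hV2.toLp V)
  have hB : Δ (Δ (toDist u)) = (B : 𝓢'(E d, ℂ)) := by
    rw [toDist_eq, biLaplacian_eq_iff]
    filter_upwards [hV2.coeFn_toLp] with ξ h2
    rw [show (𝓕 B : L2C d) = hV2.toLp V from fourier_fourierInv_eq _, h2]
    rfl
  refine ⟨rePart B, ?_, ?_⟩
  · have h1 := (isRealPart_toDist u).laplacian.laplacian
    rw [hB] at h1
    rw [IsBiLap, hB]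
    have h2 := isRealPart_rePart B
    exact (h1.unique h2)
  · refine (norm_rePart_le B).trans ?_
    have : ‖B‖ = ‖hV2.toLp V‖ := by
      rw [← Lp.norm_fourier_eq B, show (𝓕 B : L2C d) = hV2.toLp V from fourier_fourierInv_eq _]
    rw [this, ← norm_fhat w]
    refine Lp.norm_le_norm_of_ae_le ?_
    filter_upwards [hle, hV2.coeFn_toLp] with ξ h1 h2
    rwa [h2]

theorem IsPoisson.norm_sq_le (hd : 5 ≤ d) {u w : L2 d} (h : IsPoisson u w)
    (hw : Integrable (w : E d → ℝ)) {R : ℝ} (hR : 0 < R) :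
    ‖u‖ ^ 2 ≤ ((2 * Real.pi) ^ 4)⁻¹ * ((∫ x, ‖(w : E d → ℝ) x‖) ^ 2 *
      (sphereArea d * (R ^ (d - 4) / (d - 4))) + (R ^ 4)⁻¹ * ‖w‖ ^ 2) := by
  rw [← norm_fhat u, ← norm_fhat w, Lp_two_norm_sq (fhat u)]
  exact (memLp_and_integral_le hd (Lp.aestronglyMeasurable _) (fhat w) (ae_norm_fhat_le w hw)
    ((isPoisson_iff u w).mp h)).2 R hR

/-- The Sobolev embedding `H⁴ ⊂ L^∞`. -/
theorem exists_isEmbeddingConst (hd : d ≤ 7) : ∃ c : ℝ, IsEmbeddingConst d c := by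
  -- The transform of φ is k times the transform of φ + Δ²φ, and k decays like |ξ|⁻⁴, hence is in L²
  -- for d < 8. Cauchy–Schwarz then makes the transform of φ integrable.
  let k : E d → ℝ := fun ξ => (1 + symbol ξ ^ 2)⁻¹
  have hpos : ∀ ξ : E d, 0 < 1 + symbol ξ ^ 2 := fun ξ => by positivity
  have hkc : Continuous k := by
    have : Continuous fun ξ : E d => 1 + symbol ξ ^ 2 := by
      unfold symbol
      fun_prop
    exact this.inv₀ fun ξ => (hpos ξ).ne'
  have hk : MemLp k 2 := by
    rw [memLp_two_iff_integrable_sq hkc.aestronglyMeasurable]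
    have hi : Integrable (fun ξ : E d => (1 + ‖ξ‖) ^ (-(8 : ℝ))) := by
      refine integrable_one_add_norm ?_
      rw [finrank_euclideanSpace_fin]
      exact_mod_cast (by omega : d < 8)
    -- 64 = 8², from (1 + t)⁴ ≤ 8(1 + t⁴).
    refine (hi.const_mul 64).mono' (hkc.pow 2).aestronglyMeasurable
      (Filter.Eventually.of_forall fun ξ => ?_)
    rw [Real.norm_of_nonneg (by positivity), Real.rpow_neg (by positivity)]
    have hn := norm_nonneg ξ
    have e : (1 + ‖ξ‖) ^ (8 : ℝ) = ((1 + ‖ξ‖) ^ 4) ^ 2 := by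
      rw [← pow_mul]
      exact_mod_cast Real.rpow_natCast (1 + ‖ξ‖) 8
    rw [e]
    have h1 : (1 + ‖ξ‖) ^ 4 ≤ 8 * (1 + symbol ξ ^ 2) := by
      have h2 : ‖ξ‖ ^ 4 ≤ symbol ξ ^ 2 := by
        have : symbol ξ ^ 2 = (2 * Real.pi * ‖ξ‖) ^ 4 := by
          unfold symbol
          ring
        rw [this]
        gcongr
        nlinarith [Real.pi_gt_three]
      have h3 : (1 + ‖ξ‖) ^ 4 ≤ 8 * (1 + ‖ξ‖ ^ 4) := by
        nlinarith [sq_nonneg (1 - ‖ξ‖), sq_nonneg (1 - ‖ξ‖ ^ 2), sq_nonneg ((1 - ‖ξ‖) ^ 2),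
          sq_nonneg (1 + ‖ξ‖), mul_nonneg (sq_nonneg (1 - ‖ξ‖)) (sq_nonneg (1 + ‖ξ‖))]
      linarith
    have h4 : ((1 + ‖ξ‖) ^ 4) ^ 2 ≤ 64 * (1 + symbol ξ ^ 2) ^ 2 := by
      calc ((1 + ‖ξ‖) ^ 4) ^ 2 ≤ (8 * (1 + symbol ξ ^ 2)) ^ 2 := by gcongr
        _ = _ := by ring
    simp only [k]
    rw [inv_pow, ← div_eq_mul_inv, le_div_iff₀ (by positivity), inv_mul_eq_div,
      div_le_iff₀ (by positivity)]
    exact h4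
  let kC : L2 d := hk.toLp k
  -- The 2 comes from ‖φ‖ + ‖Δ²φ‖ ≤ 2‖φ‖_{H⁴}; the 1 only makes the constant visibly positive.
  refine ⟨2 * ‖kC‖ + 1, by positivity, fun φ ⟨w, hφ⟩ => ?_⟩
  have hsum : (fun ξ => fhat φ ξ) =ᵐ[volume] fun ξ => ((k ξ : ℝ) : ℂ) * (fhat φ + fhat w) ξ := by
    filter_upwards [(isBiLap_iff φ w).mp hφ, Lp.coeFn_add (fhat φ) (fhat w)] with ξ h1 h2
    rw [h2, Pi.add_apply, ← h1]
    have : ((1 + symbol ξ ^ 2 : ℝ) : ℂ) ≠ 0 := by exact_mod_cast (hpos ξ).ne'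
    have e : fhat φ ξ + ((symbol ξ ^ 2 : ℝ) : ℂ) * fhat φ ξ
        = ((1 + symbol ξ ^ 2 : ℝ) : ℂ) * fhat φ ξ := by
      push_cast
      ring
    rw [e]
    simp only [k, Complex.ofReal_inv]
    rw [inv_mul_cancel_left₀ this]
  have hkM : MemLp (fun ξ => ((k ξ : ℝ) : ℂ)) 2 (volume : Measure (E d)) := hk.ofReal
  have hint : Integrable (fun ξ => ((k ξ : ℝ) : ℂ) * (fhat φ + fhat w) ξ) :=
    hkM.integrable_mul (Lp.memLp _)
  have hb := ae_norm_le_integral_fourier (toComplex φ) (hint.congr hsum.symm)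
  have hbound : ∫ ξ, ‖fhat φ ξ‖ ≤ ‖kC‖ * ‖fhat φ + fhat w‖ := by
    have e1 : ∫ ξ, ‖fhat φ ξ‖ = ∫ ξ, ‖k ξ‖ * ‖(fhat φ + fhat w) ξ‖ := by
      refine integral_congr_ae ?_
      filter_upwards [hsum] with ξ hξ
      rw [hξ, norm_mul, Complex.norm_real]
    have e2 := integral_mul_norm_le_Lp_mul_Lq (μ := (volume : Measure (E d))) (f := k)
      (g := fun ξ => ‖(fhat φ + fhat w) ξ‖) Real.HolderConjugate.two_two
      (by simpa using hk) (by simpa using (Lp.memLp (fhat φ + fhat w)).norm)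
    simp only [norm_norm] at e2
    have e3 : ‖kC‖ = (∫ ξ, ‖k ξ‖ ^ (2 : ℝ)) ^ (1 / 2 : ℝ) := by
      rw [← Real.sqrt_eq_rpow, ← Real.sqrt_sq (norm_nonneg kC), Lp_two_norm_sq]
      congr 1
      refine integral_congr_ae ?_
      filter_upwards [hk.coeFn_toLp] with ξ hξ
      rw [hξ]
      norm_cast
    have e4 : ‖fhat φ + fhat w‖
        = (∫ ξ, ‖(fhat φ + fhat w) ξ‖ ^ (2 : ℝ)) ^ (1 / 2 : ℝ) := by
      rw [← Real.sqrt_eq_rpow, ← Real.sqrt_sq (norm_nonneg (fhat φ + fhat w)), Lp_two_norm_sq]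
      norm_cast
    rw [e1, e3, e4]
    exact e2
  have hH : ‖fhat φ + fhat w‖ ≤ 2 * h4Norm φ := by
    refine (norm_add_le _ _).trans ?_
    rw [norm_fhat, norm_fhat, h4Norm, hφ.biLap_eq]
    have h1 : ‖φ‖ ≤ √(‖φ‖ ^ 2 + ‖w‖ ^ 2) := Real.le_sqrt_of_sq_le (by nlinarith [sq_nonneg ‖w‖])
    have h2 : ‖w‖ ≤ √(‖φ‖ ^ 2 + ‖w‖ ^ 2) := Real.le_sqrt_of_sq_le (by nlinarith [sq_nonneg ‖φ‖])
    linarith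
  have hH0 : 0 ≤ h4Norm φ := Real.sqrt_nonneg _
  rw [eLpNorm_exponent_top]
  refine eLpNormEssSup_le_of_ae_bound ?_
  filter_upwards [hb, toComplex_ae φ] with x h1 h2
  rw [h2, Complex.norm_real] at h1
  have : ‖kC‖ * ‖fhat φ + fhat w‖ ≤ ‖kC‖ * (2 * h4Norm φ) := by gcongr
  calc ‖(φ : E d → ℝ) x‖ ≤ ∫ ξ, ‖fhat φ ξ‖ := h1
    _ ≤ (2 * ‖kC‖ + 1) * h4Norm φ := by linarith

end Linear

/-! ### Pointwise bounds for the nonlinearity on the ball I -/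

section Nonlinearity

variable {N : ℕ} {I : Set (E N)}

theorem cNorm_nonneg (I : Set (E N)) (h : E N → ℝ) : 0 ≤ cNorm I h :=
  Real.sSup_nonneg (by rintro _ ⟨z, -, rfl⟩; exact abs_nonneg _)

theorem abs_le_cNorm (hI : IsCompact I) {h : E N → ℝ} (hh : ContinuousOn h I) {z : E N}
    (hz : z ∈ I) : |h z| ≤ cNorm I h :=
  le_csSup (hI.image_of_continuousOn hh.abs).bddAbove ⟨z, hz, rfl⟩

/-- The ℓ¹ sum of the coordinates dominates the operator norm; this matches the sums of partial
derivatives in `c2Norm`. -/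
theorem norm_le_sum_apply_single (L : E N →L[ℝ] ℝ) :
    ‖L‖ ≤ ∑ n, |L (EuclideanSpace.single n 1)| := by
  refine L.opNorm_le_bound (Finset.sum_nonneg fun n _ => abs_nonneg _) fun v => ?_
  have hv : v = ∑ n, v n • (EuclideanSpace.single n (1 : ℝ) : E N) := by
    have := (EuclideanSpace.basisFun (Fin N) ℝ).sum_repr v
    simpa using this.symm
  calc ‖L v‖ = ‖∑ n, v n * L (EuclideanSpace.single n 1)‖ := by
        conv_lhs => rw [hv]
        simp [map_sum]
    _ ≤ ∑ n, ‖v n * L (EuclideanSpace.single n 1)‖ := norm_sum_le _ _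
    _ ≤ ∑ n, |L (EuclideanSpace.single n 1)| * ‖v‖ := by
        refine Finset.sum_le_sum fun n _ => ?_
        rw [norm_mul, mul_comm, Real.norm_eq_abs (L _)]
        gcongr
        exact PiLp.norm_apply_le v n
    _ = _ := by rw [Finset.sum_mul]

/-- A convex set with nonempty interior has unique derivatives up to its boundary, so `fderivWithin`
on I is meaningful everywhere. -/
theorem uniqueDiffOn_closedBall {r : ℝ} (hr : 0 < r) :
    UniqueDiffOn ℝ (Metric.closedBall (0 : E N) r) :=
  uniqueDiffOn_convex (convex_closedBall _ _)
    ⟨0, interior_mono Metric.ball_subset_closedBall (by simpa [Metric.isOpen_ball.interior_eq])⟩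

theorem contDiffOn_partialOn (hI : UniqueDiffOn ℝ I) {h : E N → ℝ} (hh : ContDiffOn ℝ 2 h I)
    (n : Fin N) : ContDiffOn ℝ 1 (partialOn I n h) I :=
  (hh.fderivWithin hI (m := 1) (by norm_num)).clm_apply contDiffOn_const

theorem continuousOn_partialOn (hI : UniqueDiffOn ℝ I) {h : E N → ℝ} (hh : ContDiffOn ℝ 1 h I)
    (n : Fin N) : ContinuousOn (partialOn I n h) I :=
  (hh.continuousOn_fderivWithin hI (by norm_num)).clm_apply continuousOn_const

theorem norm_fderivWithin_le_sum (hc : IsCompact I) (hI : UniqueDiffOn ℝ I) {h : E N → ℝ}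
    (hh : ContDiffOn ℝ 1 h I) {z : E N} (hz : z ∈ I) :
    ‖fderivWithin ℝ h I z‖ ≤ ∑ n, cNorm I (partialOn I n h) :=
  (norm_le_sum_apply_single _).trans
    (Finset.sum_le_sum fun n _ => abs_le_cNorm hc (continuousOn_partialOn hI hh n) hz)

variable {r M : ℝ} {g : Fin N → E N → ℝ}

theorem c2Norm_nonneg (I : Set (E N)) (h : E N → ℝ) : 0 ≤ c2Norm I h := by
  have h1 := cNorm_nonneg I h
  have h2 : 0 ≤ ∑ n, cNorm I (partialOn I n h) := Finset.sum_nonneg fun n _ => cNorm_nonneg _ _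
  have h3 : 0 ≤ ∑ n, ∑ l, cNorm I (partialOn I n (partialOn I l h)) :=
    Finset.sum_nonneg fun n _ => Finset.sum_nonneg fun l _ => cNorm_nonneg _ _
  unfold c2Norm
  linarith

theorem NonlinAssumption.c2Norm_le (hg : NonlinAssumption I M g) (m : Fin N) :
    c2Norm I (g m) ≤ M :=
  (Finset.single_le_sum (f := fun m => c2Norm I (g m)) (fun _ _ => c2Norm_nonneg _ _)
    (Finset.mem_univ m)).trans hg.norm_le

/-- `|∇g| ≤ M` on the ball. -/
theorem NonlinAssumption.norm_fderivWithin_le (hr : 0 < r)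
    (hg : NonlinAssumption (Metric.closedBall 0 r) M g) (m : Fin N) {z : E N}
    (hz : z ∈ Metric.closedBall (0 : E N) r) :
    ‖fderivWithin ℝ (g m) (Metric.closedBall 0 r) z‖ ≤ M := by
  have h := norm_fderivWithin_le_sum (isCompact_closedBall _ _) (uniqueDiffOn_closedBall hr)
    ((hg.contDiffOn m).of_le (by norm_num)) hz
  have h1 := cNorm_nonneg (Metric.closedBall 0 r) (g m)
  have h3 : 0 ≤ ∑ n, ∑ l, cNorm (Metric.closedBall 0 r) (partialOn (Metric.closedBall 0 r) n
      (partialOn (Metric.closedBall 0 r) l (g m))) :=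
    Finset.sum_nonneg fun n _ => Finset.sum_nonneg fun l _ => cNorm_nonneg _ _
  have h4 := hg.c2Norm_le m
  unfold c2Norm at h4
  linarith

/-- `|∇g(z)| ≤ M |z|` on the ball. -/
theorem NonlinAssumption.norm_fderivWithin_le_mul (hr : 0 < r)
    (hg : NonlinAssumption (Metric.closedBall 0 r) M g) (m : Fin N) {z : E N}
    (hz : z ∈ Metric.closedBall (0 : E N) r) :
    ‖fderivWithin ℝ (g m) (Metric.closedBall 0 r) z‖ ≤ M * ‖z‖ := by
  set I := Metric.closedBall (0 : E N) r with hI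
  have hc : IsCompact I := isCompact_closedBall _ _
  have hu : UniqueDiffOn ℝ I := uniqueDiffOn_closedBall hr
  have h0 : (0 : E N) ∈ I := by simp [hI, hr.le]
  have hzero : ∀ l, partialOn I l (g m) 0 = 0 := by
    intro l
    have hd : HasFDerivWithinAt (g m) (0 : E N →L[ℝ] ℝ) I 0 := by
      have h1 : HasFDerivAt (g m) (0 : E N →L[ℝ] ℝ) 0 := by simpa using (hg.grad_zero m).hasFDerivAt
      exact h1.hasFDerivWithinAt
    rw [partialOn, hd.fderivWithin (hu 0 h0)]
    rfl
  -- Mean value inequality from 0, where each partial derivative vanishes, with the second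
  -- derivatives as Lipschitz constant.
  have hpart : ∀ l, |partialOn I l (g m) z|
      ≤ (∑ n, cNorm I (partialOn I n (partialOn I l (g m)))) * ‖z‖ := by
    intro l
    have hC1 := contDiffOn_partialOn hu (hg.contDiffOn m) l
    have := (convex_closedBall (0 : E N) r).norm_image_sub_le_of_norm_fderivWithin_le
      (hC1.differentiableOn (by norm_num))
      (fun x hx => norm_fderivWithin_le_sum hc hu hC1 hx) h0 hz
    simpa [hzero] using this
  have h4 := hg.c2Norm_le m
  have h1 := cNorm_nonneg I (g m)
  have h2 : 0 ≤ ∑ n, cNorm I (partialOn I n (g m)) := Finset.sum_nonneg fun n _ => cNorm_nonneg _ _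
  unfold c2Norm at h4
  rw [Finset.sum_comm] at h4
  calc ‖fderivWithin ℝ (g m) I z‖ ≤ ∑ l, |partialOn I l (g m) z| := norm_le_sum_apply_single _
    _ ≤ ∑ l, (∑ n, cNorm I (partialOn I n (partialOn I l (g m)))) * ‖z‖ :=
        Finset.sum_le_sum fun l _ => hpart l
    _ = (∑ l, ∑ n, cNorm I (partialOn I n (partialOn I l (g m)))) * ‖z‖ := by
        rw [Finset.sum_mul]
    _ ≤ M * ‖z‖ := by
        gcongr
        linarith

theorem NonlinAssumption.abs_sub_le (hr : 0 < r)
    (hg : NonlinAssumption (Metric.closedBall 0 r) M g) (m : Fin N) {a b : E N}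
    (ha : a ∈ Metric.closedBall (0 : E N) r) (hb : b ∈ Metric.closedBall (0 : E N) r) :
    |g m a - g m b| ≤ M * ‖a - b‖ :=
  (convex_closedBall (0 : E N) r).norm_image_sub_le_of_norm_fderivWithin_le
    ((hg.contDiffOn m).differentiableOn (by norm_num))
    (fun _ hx => hg.norm_fderivWithin_le hr m hx) hb ha

/-- Along the segment from b to a the gradient is at most M(t|a| + (1 - t)|b|), whose mean over [0,
1] is M(|a| + |b|)/2. The factor 1/2 is what makes the stated bound for ε sufficient. -/
theorem NonlinAssumption.abs_sub_le_mul (hr : 0 < r)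
    (hg : NonlinAssumption (Metric.closedBall 0 r) M g) (m : Fin N) {a b : E N}
    (ha : a ∈ Metric.closedBall (0 : E N) r) (hb : b ∈ Metric.closedBall (0 : E N) r) :
    |g m a - g m b| ≤ M / 2 * (‖a‖ + ‖b‖) * ‖a - b‖ := by
  set I := Metric.closedBall (0 : E N) r with hI
  have hM := hg.M_pos
  let γ : ℝ → E N := fun t => b + t • (a - b)
  have hγI : ∀ t ∈ Set.Icc (0 : ℝ) 1, γ t ∈ I := fun t ht =>
    (convex_closedBall (0 : E N) r).add_smul_sub_mem hb ha ht
  have hγn : ∀ t ∈ Set.Icc (0 : ℝ) 1, ‖γ t‖ ≤ t * ‖a‖ + (1 - t) * ‖b‖ := by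
    intro t ht
    have e : γ t = t • a + (1 - t) • b := by
      simp only [γ, smul_sub, sub_smul, one_smul]
      abel
    rw [e]
    refine (norm_add_le _ _).trans_eq ?_
    rw [norm_smul, norm_smul, Real.norm_of_nonneg ht.1, Real.norm_of_nonneg (by linarith [ht.2])]
  have hγd : ∀ t, HasDerivAt γ (a - b) t := fun t => by
    have h := ((hasDerivAt_id t).smul_const (a - b)).const_add b
    rw [one_smul] at h
    exact h
  have hd : ∀ t ∈ Set.Icc (0 : ℝ) 1, HasDerivWithinAt (fun t => g m (γ t) - g m b)
      (fderivWithin ℝ (g m) I (γ t) (a - b)) (Set.Icc 0 1) t := by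
    intro t ht
    have h1 : HasFDerivWithinAt (g m) (fderivWithin ℝ (g m) I (γ t)) I (γ t) :=
      ((hg.contDiffOn m).differentiableOn (by norm_num) _ (hγI t ht)).hasFDerivWithinAt
    exact (h1.comp_hasDerivWithinAt t (hγd t).hasDerivWithinAt hγI).sub_const _
  -- B is the antiderivative of the speed bound B' with B(0) = 0, and B(1) is the desired right-hand
  -- side.
  let B : ℝ → ℝ := fun t => M * ‖a - b‖ * (t ^ 2 / 2 * ‖a‖ + (t - t ^ 2 / 2) * ‖b‖)
  let B' : ℝ → ℝ := fun t => M * ‖a - b‖ * (t * ‖a‖ + (1 - t) * ‖b‖)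
  have hB : ∀ t, HasDerivAt B (B' t) t := by
    intro t
    have h2 : HasDerivAt (fun t : ℝ => t ^ 2 / 2) t t :=
      ((hasDerivAt_pow 2 t).div_const 2).congr_deriv (by simp)
    exact ((h2.mul_const _).add (((hasDerivAt_id t).sub h2).mul_const _)).const_mul _
  have key := image_norm_le_of_norm_deriv_right_le_deriv_boundary'
    (f := fun t => g m (γ t) - g m b) (f' := fun t => fderivWithin ℝ (g m) I (γ t) (a - b))
    (a := 0) (b := 1) (B := B) (B' := B')
    (fun t ht => (hd t ht).continuousWithinAt)
    (fun t ht => (hd t ⟨ht.1, ht.2.le⟩).mono_of_mem_nhdsWithin (Icc_mem_nhdsGE_of_mem ht))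
    (by simp [γ, B])
    (fun t _ => (hB t).continuousAt.continuousWithinAt)
    (fun t _ => (hB t).hasDerivWithinAt)
    (fun t ht => by
      have ht' : t ∈ Set.Icc (0 : ℝ) 1 := ⟨ht.1, ht.2.le⟩
      calc ‖fderivWithin ℝ (g m) I (γ t) (a - b)‖
          ≤ ‖fderivWithin ℝ (g m) I (γ t)‖ * ‖a - b‖ := ContinuousLinearMap.le_opNorm _ _
        _ ≤ M * (t * ‖a‖ + (1 - t) * ‖b‖) * ‖a - b‖ := by
            gcongr
            exact (hg.norm_fderivWithin_le_mul hr m (hγI t ht')).trans (by gcongr; exact hγn t ht')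
        _ = B' t := by
            simp only [B']
            ring)
    (Set.right_mem_Icc.mpr zero_le_one)
  have e1 : γ 1 = a := by simp [γ]
  simp only [e1, B, Real.norm_eq_abs] at key
  linarith

end Nonlinearity

/-! ### H⁴ as a closed subspace of a Hilbert space -/

section Space

variable {d N : ℕ}

theorem toDist_add (φ ψ : L2 d) : toDist (φ + ψ) = toDist φ + toDist ψ := by
  have h : toComplex (φ + ψ) = toComplex φ + toComplex ψ :=
    (Complex.ofRealCLM.compLpₗ 2 volume).map_add φ ψ
  rw [toDist_eq, h]
  exact map_add (Lp.toTemperedDistributionCLM ℂ volume 2) _ _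

theorem toDist_sub (φ ψ : L2 d) : toDist (φ - ψ) = toDist φ - toDist ψ := by
  rw [eq_sub_iff_add_eq, ← toDist_add, sub_add_cancel]

theorem toDist_zero : toDist (0 : L2 d) = 0 := by
  simpa using toDist_sub (0 : L2 d) 0

theorem continuous_toDist : Continuous (toDist (d := d)) :=
  (Lp.toTemperedDistributionCLM ℂ volume 2).continuous.comp
    (Complex.ofRealCLM.compLpL 2 (volume : Measure (E d))).continuous

theorem laplacian_add (S T : 𝓢'(E d, ℂ)) : Δ (S + T) = Δ S + Δ T := by
  simpa only [TemperedDistribution.laplacianCLM_apply] using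
    map_add (LineDeriv.laplacianCLM ℂ (E d) 𝓢'(E d, ℂ)) S T

theorem laplacian_sub (S T : 𝓢'(E d, ℂ)) : Δ (S - T) = Δ S - Δ T := by
  simpa only [TemperedDistribution.laplacianCLM_apply] using
    map_sub (LineDeriv.laplacianCLM ℂ (E d) 𝓢'(E d, ℂ)) S T

theorem continuous_laplacian : Continuous fun T : 𝓢'(E d, ℂ) => Δ T :=
  (LineDeriv.laplacianCLM ℂ (E d) 𝓢'(E d, ℂ)).continuous.congr fun T =>
    TemperedDistribution.laplacianCLM_apply T

theorem IsBiLap.add {φ ψ v w : L2 d} (h : IsBiLap φ v) (h' : IsBiLap ψ w) :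
    IsBiLap (φ + ψ) (v + w) := by
  unfold IsBiLap at *
  rw [toDist_add, laplacian_add, laplacian_add, h, h', toDist_add]

theorem IsBiLap.sub {φ ψ v w : L2 d} (h : IsBiLap φ v) (h' : IsBiLap ψ w) :
    IsBiLap (φ - ψ) (v - w) := by
  unfold IsBiLap at *
  rw [toDist_sub, laplacian_sub, laplacian_sub, h, h', toDist_sub]

theorem IsPoisson.add {φ ψ v w : L2 d} (h : IsPoisson φ v) (h' : IsPoisson ψ w) :
    IsPoisson (φ + ψ) (v + w) := by
  unfold IsPoisson at *
  rw [toDist_add, laplacian_add, laplacian_add, toDist_add, ← h, ← h']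
  abel

theorem IsPoisson.sub {φ ψ v w : L2 d} (h : IsPoisson φ v) (h' : IsPoisson ψ w) :
    IsPoisson (φ - ψ) (v - w) := by
  unfold IsPoisson at *
  rw [toDist_sub, laplacian_sub, laplacian_sub, toDist_sub, ← h, ← h']
  abel

theorem isBiLap_zero : IsBiLap (0 : L2 d) 0 := by
  unfold IsBiLap
  have : Δ (0 : 𝓢'(E d, ℂ)) = 0 := by simpa using laplacian_sub (0 : 𝓢'(E d, ℂ)) 0
  rw [toDist_zero, this, this]

theorem isPoisson_zero : IsPoisson (0 : L2 d) 0 := by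
  unfold IsPoisson
  have : Δ (0 : 𝓢'(E d, ℂ)) = 0 := by simpa using laplacian_sub (0 : 𝓢'(E d, ℂ)) 0
  rw [toDist_zero, this, this]
  simp

theorem MemH4.isBiLap {φ : L2 d} (h : MemH4 φ) : IsBiLap φ (biLap φ) := by
  obtain ⟨w, hw⟩ := h
  rwa [hw.biLap_eq]

/-- Both sides of the defining equation are continuous in the weaker topology of distributions, so
Δ² is a closed operator on L². -/
theorem isClosed_isBiLap : IsClosed {p : L2 d × L2 d | IsBiLap p.1 p.2} :=
  isClosed_eq (continuous_laplacian.comp (continuous_laplacian.comp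
    (continuous_toDist.comp continuous_fst))) (continuous_toDist.comp continuous_snd)

theorem MemH4Vec.add {u v : Fin N → L2 d} (hu : MemH4Vec u) (hv : MemH4Vec v) :
    MemH4Vec (u + v) := fun m => ⟨_, (hu m).isBiLap.add (hv m).isBiLap⟩

theorem MemH4Vec.sub {u v : Fin N → L2 d} (hu : MemH4Vec u) (hv : MemH4Vec v) :
    MemH4Vec (u - v) := fun m => ⟨_, (hu m).isBiLap.sub (hv m).isBiLap⟩

theorem memH4Vec_zero : MemH4Vec (0 : Fin N → L2 d) := fun _ => ⟨0, isBiLap_zero⟩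

/-- The Hilbert space in which `H⁴(ℝ^d, ℝ^N)` sits through `u ↦ (u, Δ²u)`. -/
abbrev GraphSpace (d N : ℕ) : Type := PiLp 2 fun _ : Fin N => WithLp 2 (L2 d × L2 d)

/-- The embedding `u ↦ (u, Δ²u)`. -/
noncomputable def graphMap (u : Fin N → L2 d) : GraphSpace d N :=
  WithLp.toLp 2 fun m => WithLp.toLp 2 (u m, biLap (u m))

theorem norm_graphMap (u : Fin N → L2 d) : ‖graphMap u‖ = h4NormVec u := by
  rw [PiLp.norm_eq_of_L2, h4NormVec]
  congr 1
  refine Finset.sum_congr rfl fun m _ => ?_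
  rw [WithLp.prod_norm_eq_of_L2]
  rfl

/-- Membership is needed: `biLap` takes the default value 0 outside H⁴ and is not additive there. -/
theorem graphMap_add {u v : Fin N → L2 d} (hu : MemH4Vec u) (hv : MemH4Vec v) :
    graphMap (u + v) = graphMap u + graphMap v := by
  ext m : 2
  simp only [graphMap, Pi.add_apply, PiLp.add_apply]
  rw [((hu m).isBiLap.add (hv m).isBiLap).biLap_eq, ← WithLp.toLp_add]
  rfl

theorem graphMap_sub {u v : Fin N → L2 d} (hu : MemH4Vec u) (hv : MemH4Vec v) :
    graphMap (u - v) = graphMap u - graphMap v := by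
  rw [eq_sub_iff_add_eq, ← graphMap_add (hu.sub hv) hv, sub_add_cancel]

theorem graphMap_injective : Function.Injective (graphMap (d := d) (N := N)) := fun u v h => by
  funext m
  exact congrArg (fun p : GraphSpace d N => (p m).fst) h

theorem h4NormVec_nonneg (u : Fin N → L2 d) : 0 ≤ h4NormVec u := Real.sqrt_nonneg _

theorem h4NormVec_zero : h4NormVec (0 : Fin N → L2 d) = 0 := by
  rw [h4NormVec]
  simp [h4Norm, isBiLap_zero.biLap_eq]

theorem h4NormVec_add_le {u v : Fin N → L2 d} (hu : MemH4Vec u) (hv : MemH4Vec v) :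
    h4NormVec (u + v) ≤ h4NormVec u + h4NormVec v := by
  rw [← norm_graphMap, graphMap_add hu hv, ← norm_graphMap, ← norm_graphMap]
  exact norm_add_le _ _

/-- The image is the intersection of the closed graph condition in each component with a closed
ball. This is the completeness of B_ρ. -/
theorem isClosed_graphMap_ball (ρ : ℝ) : IsClosed (graphMap '' ballH4 d N ρ) := by
  have h : graphMap '' ballH4 d N ρ
      = {p : GraphSpace d N | ∀ m, IsBiLap (p m).fst (p m).snd} ∩ Metric.closedBall 0 ρ := by
    ext p
    constructor
    · rintro ⟨u, ⟨hu, hn⟩, rfl⟩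
      exact ⟨fun m => (hu m).isBiLap, by simpa [norm_graphMap] using hn⟩
    · rintro ⟨h1, h2⟩
      have hp : graphMap (fun m => (p m).fst) = p := by
        ext m : 2
        simp only [graphMap]
        rw [(h1 m).biLap_eq]
        rfl
      refine ⟨fun m => (p m).fst, ⟨fun m => ⟨_, h1 m⟩, ?_⟩, hp⟩
      rw [← norm_graphMap, hp]
      simpa using h2
  rw [h]
  refine IsClosed.inter ?_ Metric.isClosed_closedBall
  rw [Set.ofPred_forall]
  refine isClosed_iInter fun m => ?_
  have hc : Continuous fun p : GraphSpace d N => ((p m).fst, (p m).snd) := by fun_prop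
  exact isClosed_isBiLap.preimage hc

theorem memLp_evalVec (u : Fin N → L2 d) : MemLp (evalVec u) 2 := by
  refine MemLp.of_eval_piLp fun j => ?_
  exact Lp.memLp (u j)

/-- The vector function `u` as an element of `L²(ℝ^d, ℝ^N)`. -/
noncomputable def evalLp (u : Fin N → L2 d) : Lp (E N) 2 (volume : Measure (E d)) :=
  (memLp_evalVec u).toLp

theorem evalLp_ae (u : Fin N → L2 d) : evalLp u =ᵐ[volume] evalVec u :=
  (memLp_evalVec u).coeFn_toLp

theorem norm_evalLp_le (u : Fin N → L2 d) : ‖evalLp u‖ ≤ h4NormVec u := by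
  refine Real.le_sqrt_of_sq_le ?_
  have h1 : ‖evalLp u‖ ^ 2 = ∑ m, ‖u m‖ ^ 2 := by
    rw [Lp_two_norm_sq]
    have : ∫ x, ‖evalLp u x‖ ^ 2 = ∫ x, ∑ m, ‖(u m : E d → ℝ) x‖ ^ 2 := by
      refine integral_congr_ae ?_
      filter_upwards [evalLp_ae u] with x hx
      rw [hx, EuclideanSpace.norm_sq_eq]
      rfl
    rw [this, integral_finsetSum _ fun m _ => (Lp.memLp (u m)).integrable_norm_pow two_ne_zero]
    exact Finset.sum_congr rfl fun m _ => (Lp_two_norm_sq (u m)).symm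
  rw [h1]
  refine Finset.sum_le_sum fun m _ => ?_
  rw [h4Norm, Real.sq_sqrt (by positivity)]
  nlinarith [sq_nonneg ‖biLap (u m)‖]

theorem evalVec_sub_ae (u v : Fin N → L2 d) :
    evalVec (u - v) =ᵐ[volume] fun x => evalVec u x - evalVec v x := by
  have h : ∀ᵐ x, ∀ m, ((u m - v m : L2 d) : E d → ℝ) x = (u m : E d → ℝ) x - (v m : E d → ℝ) x :=
    ae_all_iff.mpr fun m => Lp.coeFn_sub (u m) (v m)
  filter_upwards [h] with x hx
  ext m
  exact hx m

theorem evalVec_zero_ae : evalVec (0 : Fin N → L2 d) =ᵐ[volume] 0 := by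
  have h : ∀ᵐ x, ∀ _ : Fin N, ((0 : L2 d) : E d → ℝ) x = 0 :=
    ae_all_iff.mpr fun m => Lp.coeFn_zero ℝ 2 volume
  filter_upwards [h] with x hx
  ext m
  exact hx m

/-- Squaring and summing the scalar bounds keeps the same constant c, with no factor depending on N.
-/
theorem IsEmbeddingConst.norm_evalVec_le {c : ℝ} (hc : IsEmbeddingConst d c)
    {u : Fin N → L2 d} (hu : MemH4Vec u) : ∀ᵐ x, ‖evalVec u x‖ ≤ c * h4NormVec u := by
  have h : ∀ᵐ x, ∀ m, ‖(u m : E d → ℝ) x‖ ≤ c * h4Norm (u m) := by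
    refine ae_all_iff.mpr fun m => ?_
    have h0 : 0 ≤ c * h4Norm (u m) := mul_nonneg hc.1.le (Real.sqrt_nonneg _)
    have h1 := hc.2 (u m) (hu m)
    rw [eLpNorm_exponent_top] at h1
    filter_upwards [ae_le_eLpNormEssSup (f := (u m : E d → ℝ)) (μ := volume)] with x hx
    have h2 := hx.trans h1
    rwa [← ofReal_norm, ENNReal.ofReal_le_ofReal_iff h0] at h2
  filter_upwards [h] with x hx
  have hc0 := hc.1.le
  rw [EuclideanSpace.norm_eq, h4NormVec, ← Real.sqrt_sq hc0, ← Real.sqrt_mul (sq_nonneg c)]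
  refine Real.sqrt_le_sqrt ?_
  rw [Finset.mul_sum]
  refine Finset.sum_le_sum fun m _ => ?_
  rw [← mul_pow]
  exact pow_le_pow_left₀ (norm_nonneg _) (hx m) 2

end Space

/-! ### Convolution and superposition operators in L¹ and L² -/

section Superposition

variable {d N : ℕ}

theorem lpNormReal_one_eq {f : E d → ℝ} (hf : AEStronglyMeasurable f) :
    lpNormReal 1 f = ∫ x, ‖f x‖ := by
  rw [lpNormReal, eLpNorm_one_eq_lintegral_enorm, integral_norm_eq_lintegral_enorm hf]

theorem lpNormReal_congr {p : ENNReal} {f g : E d → ℝ} (h : f =ᵐ[volume] g) :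
    lpNormReal p f = lpNormReal p g := by
  rw [lpNormReal, lpNormReal, eLpNorm_congr_ae h]

theorem lpNormReal_nonneg (p : ENNReal) (f : E d → ℝ) : 0 ≤ lpNormReal p f :=
  ENNReal.toReal_nonneg

theorem lpNormReal_const_mul (p : ENNReal) (c : ℝ) (f : E d → ℝ) :
    lpNormReal p (fun x => c * f x) = |c| * lpNormReal p f := by
  have := eLpNorm_const_smul c f p volume
  simp only [lpNormReal]
  rw [show (fun x => c * f x) = c • f from rfl, this]
  simp

variable {H G : E d → ℝ}

theorem memLp_two_conv (hH1 : MemLp H 1) (hG1 : MemLp G 1) (hG2 : MemLp G 2) :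
    MemLp (fun x => ∫ y, H (x - y) * G y) 2 := by
  refine ⟨aestronglyMeasurable_conv (memLp_one_iff_integrable.mp hG1)
    (memLp_one_iff_integrable.mp hH1), ?_⟩
  simp_rw [integral_sub_mul_eq]
  exact (eLpNorm_two_conv_le hH1.1 hG1.1).trans_lt (ENNReal.mul_lt_top hH1.2 hG2.2)

theorem memLp_one_conv (hH1 : MemLp H 1) (hG1 : MemLp G 1) :
    MemLp (fun x => ∫ y, H (x - y) * G y) 1 := by
  refine ⟨aestronglyMeasurable_conv (memLp_one_iff_integrable.mp hG1)
    (memLp_one_iff_integrable.mp hH1), ?_⟩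
  simp_rw [integral_sub_mul_eq]
  exact (eLpNorm_one_conv_le hH1.1 hG1.1).trans_lt (ENNReal.mul_lt_top hH1.2 hG1.2)

theorem lpNormReal_one_conv_le (hH1 : MemLp H 1) (hG1 : MemLp G 1) :
    lpNormReal 1 (fun x => ∫ y, H (x - y) * G y) ≤ lpNormReal 1 H * lpNormReal 1 G := by
  simp_rw [integral_sub_mul_eq, lpNormReal]
  rw [← ENNReal.toReal_mul]
  exact ENNReal.toReal_mono (ENNReal.mul_lt_top hH1.2 hG1.2).ne (eLpNorm_one_conv_le hH1.1 hG1.1)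

theorem lpNormReal_two_conv_le (hH1 : MemLp H 1) (hG2 : MemLp G 2) :
    lpNormReal 2 (fun x => ∫ y, H (x - y) * G y) ≤ lpNormReal 1 H * lpNormReal 2 G := by
  simp_rw [integral_sub_mul_eq, lpNormReal]
  rw [← ENNReal.toReal_mul]
  exact ENNReal.toReal_mono (ENNReal.mul_lt_top hH1.2 hG2.2).ne (eLpNorm_two_conv_le hH1.1 hG2.1)

/-- Young's inequality with the two factors exchanged: the kernel carries the L² norm, which is how
Q² enters. -/
theorem lpNormReal_two_conv_le' (hH2 : MemLp H 2) (hG1 : MemLp G 1) :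
    lpNormReal 2 (fun x => ∫ y, H (x - y) * G y) ≤ lpNormReal 2 H * lpNormReal 1 G := by
  rw [mul_comm, lpNormReal, lpNormReal, lpNormReal, ← ENNReal.toReal_mul]
  refine ENNReal.toReal_mono (ENNReal.mul_lt_top hG1.2 hH2.2).ne ?_
  simp_rw [fun x y => mul_comm (H (x - y)) (G y)]
  exact eLpNorm_two_conv_le hG1.1 hH2.1

variable {r M : ℝ} {g : Fin N → E N → ℝ}

theorem NonlinAssumption.aestronglyMeasurable_comp
    (hg : NonlinAssumption (Metric.closedBall 0 r) M g) (m : Fin N) {a : Fin N → L2 d}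
    (ha : ∀ᵐ x, evalVec a x ∈ Metric.closedBall (0 : E N) r) :
    AEStronglyMeasurable fun x => g m (evalVec a x) := by
  -- Regularity of g is assumed only on I, so g is cut off to 0 outside it; the arguments lie in I
  -- almost everywhere.
  have hmeas : Measurable ((Metric.closedBall (0 : E N) r).indicator (g m)) := by
    classical
    have := (hg.contDiffOn m).continuousOn.measurable_piecewise
      (continuousOn_const (c := (0 : ℝ))) Metric.isClosed_closedBall.measurableSet
    convert this using 1
    funext x
    simp [Set.indicator, Set.piecewise]
  have h := hmeas.comp_aemeasurable (memLp_evalVec a).1.aemeasurable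
  refine h.aestronglyMeasurable.congr ?_
  filter_upwards [ha] with x hx
  simp only [Function.comp_apply]
  rw [Set.indicator_of_mem hx]

/-- `L¹` and `L²` bounds for the difference of two superpositions. -/
theorem NonlinAssumption.superposition_sub (hr : 0 < r)
    (hg : NonlinAssumption (Metric.closedBall 0 r) M g) (m : Fin N) {a b : Fin N → L2 d}
    (ha : ∀ᵐ x, evalVec a x ∈ Metric.closedBall (0 : E N) r)
    (hb : ∀ᵐ x, evalVec b x ∈ Metric.closedBall (0 : E N) r) :
    MemLp (fun x => g m (evalVec a x) - g m (evalVec b x)) 1 ∧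
    MemLp (fun x => g m (evalVec a x) - g m (evalVec b x)) 2 ∧
    lpNormReal 1 (fun x => g m (evalVec a x) - g m (evalVec b x))
      ≤ M / 2 * (‖evalLp a‖ + ‖evalLp b‖) * ‖evalLp (a - b)‖ ∧
    lpNormReal 2 (fun x => g m (evalVec a x) - g m (evalVec b x)) ≤ M * ‖evalLp (a - b)‖ := by
  have hM := hg.M_pos
  have hmeas : AEStronglyMeasurable fun x => g m (evalVec a x) - g m (evalVec b x) :=
    (hg.aestronglyMeasurable_comp m ha).sub (hg.aestronglyMeasurable_comp m hb)
  have hS2 : ∀ᵐ x, ‖g m (evalVec a x) - g m (evalVec b x)‖ ≤ ‖M • evalLp (a - b) x‖ := by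
    filter_upwards [ha, hb, evalLp_ae (a - b), evalVec_sub_ae a b] with x h1 h2 h3 h4
    rw [h3, h4, norm_smul, Real.norm_of_nonneg hM.le]
    exact hg.abs_sub_le hr m h1 h2
  let P : E d → ℝ := fun x => M / 2 * (‖evalLp a x‖ + ‖evalLp b x‖)
  have hP : MemLp P 2 := (((Lp.memLp (evalLp a)).norm.add (Lp.memLp (evalLp b)).norm)).const_mul _
  have hS1 : ∀ᵐ x, ‖g m (evalVec a x) - g m (evalVec b x)‖ ≤ ‖P x * ‖evalLp (a - b) x‖‖ := by
    filter_upwards [ha, hb, evalLp_ae (a - b), evalVec_sub_ae a b, evalLp_ae a, evalLp_ae b]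
      with x h1 h2 h3 h4 h5 h6
    have h0 : 0 ≤ P x * ‖evalLp (a - b) x‖ := by positivity
    rw [Real.norm_of_nonneg h0]
    simp only [P]
    rw [h3, h4, h5, h6]
    exact hg.abs_sub_le_mul hr m h1 h2
  have hQ : MemLp (fun x => ‖evalLp (a - b) x‖) 2 := (Lp.memLp _).norm
  have hPQ : MemLp (fun x => P x * ‖evalLp (a - b) x‖) 1 :=
    memLp_one_iff_integrable.mpr (hP.integrable_mul hQ)
  have hR2 : MemLp (fun x => M • evalLp (a - b) x) 2 := (Lp.memLp _).const_smul M
  refine ⟨hPQ.of_le hmeas hS1, hR2.of_le hmeas hS2, ?_, ?_⟩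
  · have hPn : (eLpNorm P 2 volume).toReal ≤ M / 2 * (‖evalLp a‖ + ‖evalLp b‖) := by
      have e : eLpNorm P 2 volume = ENNReal.ofReal (M / 2) *
          eLpNorm (fun x => ‖evalLp a x‖ + ‖evalLp b x‖) 2 volume := by
        have := eLpNorm_const_smul (M / 2) (fun x => ‖evalLp a x‖ + ‖evalLp b x‖) 2
          (volume : Measure (E d))
        rw [← ofReal_norm, Real.norm_of_nonneg (by positivity)] at this
        exact this
      have e2 : eLpNorm (fun x => ‖evalLp a x‖ + ‖evalLp b x‖) 2 volume
          ≤ eLpNorm (evalLp a) 2 volume + eLpNorm (evalLp b) 2 volume := by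
        have := eLpNorm_add_le (p := 2) (Lp.memLp (evalLp a)).norm.1 (Lp.memLp (evalLp b)).norm.1
          (by norm_num)
        rwa [eLpNorm_norm, eLpNorm_norm] at this
      rw [e, ENNReal.toReal_mul, ENNReal.toReal_ofReal (by positivity), Lp.norm_def, Lp.norm_def,
        ← ENNReal.toReal_add (Lp.memLp _).2.ne (Lp.memLp _).2.ne]
      gcongr
      exact ENNReal.add_ne_top.mpr ⟨(Lp.memLp _).2.ne, (Lp.memLp _).2.ne⟩
    have h1 : eLpNorm (fun x => P x * ‖evalLp (a - b) x‖) 1 volume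
        ≤ eLpNorm P 2 volume * eLpNorm (evalLp (a - b)) 2 volume := by
      have := eLpNorm_smul_le_mul_eLpNorm (p := 2) (q := 2) (r := 1) hQ.1 hP.1
      rwa [eLpNorm_norm] at this
    calc lpNormReal 1 (fun x => g m (evalVec a x) - g m (evalVec b x))
        ≤ (eLpNorm P 2 volume * eLpNorm (evalLp (a - b)) 2 volume).toReal :=
          ENNReal.toReal_mono (ENNReal.mul_lt_top hP.2 (Lp.memLp _).2).ne
            ((eLpNorm_mono_ae hS1).trans h1)
      _ = (eLpNorm P 2 volume).toReal * ‖evalLp (a - b)‖ := by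
          rw [ENNReal.toReal_mul, Lp.norm_def]
      _ ≤ _ := by gcongr
  · calc lpNormReal 2 (fun x => g m (evalVec a x) - g m (evalVec b x))
        ≤ (eLpNorm (fun x => M • evalLp (a - b) x) 2 volume).toReal :=
          ENNReal.toReal_mono hR2.2.ne (eLpNorm_mono_ae hS2)
      _ = M * ‖evalLp (a - b)‖ := by
          have := eLpNorm_const_smul M (evalLp (a - b)) 2 (volume : Measure (E d))
          rw [← ofReal_norm, Real.norm_of_nonneg hM.le] at this
          rw [show (fun x => M • evalLp (a - b) x) = M • (evalLp (a - b) : E d → E N) from rfl,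
            this, ENNReal.toReal_mul, ENNReal.toReal_ofReal hM.le, Lp.norm_def]

/-- This is the difference estimate with b = 0, because g(0) = 0. -/
theorem NonlinAssumption.memLp_superposition (hr : 0 < r)
    (hg : NonlinAssumption (Metric.closedBall 0 r) M g) (m : Fin N) {a : Fin N → L2 d}
    (ha : ∀ᵐ x, evalVec a x ∈ Metric.closedBall (0 : E N) r) :
    MemLp (fun x => g m (evalVec a x)) 1 ∧ MemLp (fun x => g m (evalVec a x)) 2 := by
  have h0 : ∀ᵐ x, evalVec (0 : Fin N → L2 d) x ∈ Metric.closedBall (0 : E N) r := by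
    filter_upwards [evalVec_zero_ae] with x hx
    rw [hx]
    simp [hr.le]
  have h := hg.superposition_sub hr m ha h0
  have e : (fun x => g m (evalVec a x) - g m (evalVec (0 : Fin N → L2 d) x))
      =ᵐ[volume] fun x => g m (evalVec a x) := by
    filter_upwards [evalVec_zero_ae (d := d) (N := N)] with x hx
    rw [hx, Pi.zero_apply, hg.zero m, sub_zero]
  exact ⟨h.1.ae_eq e, h.2.1.ae_eq e⟩

end Superposition

/-! ### Optimal frequency cut-off and the Lipschitz estimate -/

section Estimates

variable {d N : ℕ}

theorem exists_solvesLinear (hd : 5 ≤ d) {F : E d → ℝ} (h1 : MemLp F 1) (h2 : MemLp F 2) :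
    ∃ u, SolvesLinear F u := by
  obtain ⟨u, hu⟩ := exists_isPoisson hd (h2.toLp F)
    ((memLp_one_iff_integrable.mp h1).congr h2.coeFn_toLp.symm)
  exact ⟨u, h2.toLp F, h2.coeFn_toLp, hu⟩

theorem SolvesLinear.unique (hd : 5 ≤ d) {F : E d → ℝ} {u v : L2 d} (hu : SolvesLinear F u)
    (hv : SolvesLinear F v) : u = v := by
  obtain ⟨w, hw, hu⟩ := hu
  obtain ⟨w', hw', hv⟩ := hv
  obtain rfl : w = w' := Lp.ext (hw.trans hw'.symm)
  exact IsPoisson.unique hd hu hv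

theorem SolvesLinear.memH4 {F : E d → ℝ} {u : L2 d} (hu : SolvesLinear F u) : MemH4 u := by
  obtain ⟨w, -, hu⟩ := hu
  obtain ⟨b, hb, -⟩ := IsPoisson.exists_isBiLap hu
  exact ⟨b, hb⟩

/-- The factor of `H²` in the bound for `ε`. -/
noncomputable def freqFactor (d : ℕ) (A : ℝ) : ℝ :=
  A ^ ((8 : ℝ) / d - 2) * (sphereArea d / 4) ^ ((4 : ℝ) / d)
    * (d / ((d - 4) * (2 * Real.pi) ^ 4))

theorem sphereArea_pos (hd : 5 ≤ d) : 0 < sphereArea d := by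
  have : Nonempty (Fin d) := ⟨⟨0, by omega⟩⟩
  rw [sphereArea, Measure.toSphere_real_apply_univ, finrank_euclideanSpace_fin]
  have h1 : 0 < (volume : Measure (E d)).real (Metric.ball 0 1) :=
    ENNReal.toReal_pos (Metric.measure_ball_pos _ _ one_pos).ne' measure_ball_lt_top.ne
  have h2 : (0 : ℝ) < d := by exact_mod_cast (by omega : 0 < d)
  positivity

/-- The optimal cut-off frequency. -/
theorem exists_cutoff (hd : 5 ≤ d) {A : ℝ} (hA : 0 < A) :
    ∃ R : ℝ, 0 < R ∧ ((2 * Real.pi) ^ 4)⁻¹ *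
      (A ^ 2 * (sphereArea d * (R ^ (d - 4) / (d - 4))) + (R ^ 4)⁻¹) = A ^ 2 * freqFactor d A := by
  have hS := sphereArea_pos hd
  have hpi := Real.pi_pos
  have hd0 : (0 : ℝ) < d := by exact_mod_cast (by omega : 0 < d)
  have hd4 : (0 : ℝ) < d - 4 := by
    have : (5 : ℝ) ≤ d := by exact_mod_cast hd
    linarith
  set S := sphereArea d
  -- Setting the derivative in R of A²S R^{d-4}/(d-4) + R⁻⁴ to zero gives R^d = 4/(S A²) = 1/Z.
  -- There the first term is 4/(d-4) times the second, so the sum is R⁻⁴ d/(d-4).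
  let Z : ℝ := S / 4 * A ^ 2
  have hZ : 0 < Z := by positivity
  let R : ℝ := Z ^ (-(1 / d : ℝ))
  have hR : 0 < R := Real.rpow_pos_of_pos hZ _
  have hRd : R ^ d = Z⁻¹ := by
    rw [← Real.rpow_natCast, ← Real.rpow_mul hZ.le, ← Real.rpow_neg_one]
    congr 1
    field_simp
  have hR4 : (R ^ 4)⁻¹ = (S / 4) ^ ((4 : ℝ) / d) * A ^ ((8 : ℝ) / d) := by
    have e1 : (R ^ 4)⁻¹ = Z ^ ((4 : ℝ) / d) := by
      rw [← Real.rpow_natCast, ← Real.rpow_mul hZ.le, ← Real.rpow_neg hZ.le]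
      congr 1
      push_cast
      ring
    rw [e1, Real.mul_rpow (by positivity) (by positivity), ← Real.rpow_natCast,
      ← Real.rpow_mul hA.le]
    congr 2
    push_cast
    ring
  have hsplit : R ^ (d - 4) = R ^ d * (R ^ 4)⁻¹ := by
    rw [← div_eq_mul_inv, eq_div_iff (by positivity), ← pow_add]
    congr 1
    omega
  have hA8 : A ^ ((8 : ℝ) / d) = A ^ 2 * A ^ ((8 : ℝ) / d - 2) := by
    rw [← Real.rpow_natCast A 2, ← Real.rpow_add hA]
    congr 1
    push_cast
    ring
  refine ⟨R, hR, ?_⟩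
  have e3 : A ^ 2 * (S * (R ^ (d - 4) / (d - 4))) + (R ^ 4)⁻¹ = (R ^ 4)⁻¹ * (d / (d - 4)) := by
    rw [hsplit, hRd]
    simp only [Z]
    field_simp
    ring
  rw [e3, hR4, hA8, freqFactor]
  field_simp
  rfl

/-- ‖u‖ is bounded by frequency splitting, where an L¹ bound exactly A times the L² bound β lets β²
factor out and leaves a cut-off depending on A alone. ‖Δ²u‖ ≤ ‖w‖ uses a separate bound γ. -/
theorem IsPoisson.h4Norm_sq_le (hd : 5 ≤ d) {u w : L2 d} (h : IsPoisson u w)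
    (hw : MemLp (w : E d → ℝ) 1) {A β γ : ℝ} (hA : 0 < A)
    (h1 : lpNormReal 1 w ≤ A * β) (h2 : ‖w‖ ≤ β) (h3 : ‖w‖ ≤ γ) :
    h4Norm u ^ 2 ≤ A ^ 2 * β ^ 2 * freqFactor d A + γ ^ 2 := by
  obtain ⟨R, hR, hRA⟩ := exists_cutoff hd hA
  obtain ⟨b, hb, hbw⟩ := h.exists_isBiLap
  have hpi := Real.pi_pos
  have hS := sphereArea_pos hd
  have hd4 : (0 : ℝ) < d - 4 := by
    have : (5 : ℝ) ≤ d := by exact_mod_cast hd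
    linarith
  have hu := h.norm_sq_le hd (memLp_one_iff_integrable.mp hw) hR
  rw [← lpNormReal_one_eq hw.1] at hu
  have hn1 := lpNormReal_nonneg 1 (w : E d → ℝ)
  have hn2 := norm_nonneg w
  have hu2 : ‖u‖ ^ 2 ≤ A ^ 2 * β ^ 2 * freqFactor d A := by
    calc ‖u‖ ^ 2 ≤ ((2 * Real.pi) ^ 4)⁻¹ * ((A * β) ^ 2 *
          (sphereArea d * (R ^ (d - 4) / (d - 4))) + (R ^ 4)⁻¹ * β ^ 2) := by
          refine hu.trans ?_
          gcongr
      _ = β ^ 2 * (((2 * Real.pi) ^ 4)⁻¹ *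
          (A ^ 2 * (sphereArea d * (R ^ (d - 4) / (d - 4))) + (R ^ 4)⁻¹)) := by ring
      _ = _ := by
          rw [hRA]
          ring
  have hb2 : ‖b‖ ^ 2 ≤ γ ^ 2 := pow_le_pow_left₀ (norm_nonneg _) (hbw.trans h3) 2
  rw [h4Norm, Real.sq_sqrt (by positivity), hb.biLap_eq]
  linarith

variable {r M : ℝ} {g : Fin N → E N → ℝ} {H : Fin N → E d → ℝ} {ε : Fin N → ℝ}

theorem memLp_integralTerm (hH1 : ∀ m, MemLp (H m) 1) (hr : 0 < r)
    (hg : NonlinAssumption (Metric.closedBall 0 r) M g) (m : Fin N) {a : Fin N → L2 d}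
    (ha : ∀ᵐ x, evalVec a x ∈ Metric.closedBall (0 : E N) r) :
    MemLp (integralTerm (H m) (g m) a) 1 ∧ MemLp (integralTerm (H m) (g m) a) 2 := by
  obtain ⟨h1, h2⟩ := hg.memLp_superposition hr m ha
  exact ⟨memLp_one_conv (hH1 m) h1, memLp_two_conv (hH1 m) h1 h2⟩

/-- `u` solves the system whose right-hand side is the integral term of `a`. -/
def SolvesIntegral (ε : Fin N → ℝ) (H : Fin N → E d → ℝ) (g : Fin N → E N → ℝ)
    (a u : Fin N → L2 d) : Prop :=
  ∀ m, SolvesLinear (fun x => ε m * integralTerm (H m) (g m) a x) (u m)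

theorem exists_solvesIntegral (hd : 5 ≤ d) (hH1 : ∀ m, MemLp (H m) 1) (hr : 0 < r)
    (hg : NonlinAssumption (Metric.closedBall 0 r) M g) {a : Fin N → L2 d}
    (ha : ∀ᵐ x, evalVec a x ∈ Metric.closedBall (0 : E N) r) :
    ∃ u, SolvesIntegral ε H g a u := by
  choose u hu using fun m => exists_solvesLinear hd
    ((memLp_integralTerm hH1 hr hg m ha).1.const_mul (ε m))
    ((memLp_integralTerm hH1 hr hg m ha).2.const_mul (ε m))
  exact ⟨u, hu⟩

theorem SolvesIntegral.unique (hd : 5 ≤ d) {a u v : Fin N → L2 d}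
    (hu : SolvesIntegral ε H g a u) (hv : SolvesIntegral ε H g a v) : u = v :=
  funext fun m => (hu m).unique hd (hv m)

theorem SolvesIntegral.memH4Vec {a u : Fin N → L2 d} (hu : SolvesIntegral ε H g a u) :
    MemH4Vec u := fun m => (hu m).memH4

theorem solvesIntegral_zero (hg0 : ∀ m, g m 0 = 0) :
    SolvesIntegral ε H g (0 : Fin N → L2 d) 0 := by
  intro m
  refine ⟨0, ?_, isPoisson_zero⟩
  filter_upwards [Lp.coeFn_zero ℝ 2 (volume : Measure (E d))] with x hx
  have : integralTerm (H m) (g m) (0 : Fin N → L2 d) x = 0 := by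
    refine integral_eq_zero_of_ae ?_
    filter_upwards [evalVec_zero_ae (d := d) (N := N)] with y hy
    rw [hy, Pi.zero_apply, hg0 m, mul_zero, Pi.zero_apply]
  rw [hx, this, mul_zero, Pi.zero_apply]

/-- The Lipschitz estimate for the solution map. -/
theorem SolvesIntegral.h4NormVec_sub_sq_le (hd : 5 ≤ d) (hH1 : ∀ m, MemLp (H m) 1)
    (hH2 : ∀ m, MemLp (H m) 2) (hr : 0 < r)
    (hg : NonlinAssumption (Metric.closedBall 0 r) M g) {e A δ : ℝ} (hε : ∀ m, 0 ≤ ε m)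
    (hεe : ∀ m, ε m ≤ e) (hA : 0 < A) {a b U V : Fin N → L2 d}
    (ha : ∀ᵐ x, evalVec a x ∈ Metric.closedBall (0 : E N) r)
    (hb : ∀ᵐ x, evalVec b x ∈ Metric.closedBall (0 : E N) r)
    (haA : ‖evalLp a‖ ≤ A) (hbA : ‖evalLp b‖ ≤ A) (hab : ‖evalLp (a - b)‖ ≤ δ)
    (hU : SolvesIntegral ε H g a U) (hV : SolvesIntegral ε H g b V) :
    h4NormVec (U - V) ^ 2 ≤ (e * M * A * δ) ^ 2 * (sumSqL1 H * freqFactor d A + sumSqL2 H) := by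
  have hM := hg.M_pos
  have hδ : 0 ≤ δ := (norm_nonneg _).trans hab
  have hX : 0 ≤ freqFactor d A := by
    have hd4 : (0 : ℝ) < d - 4 := by
      have : (5 : ℝ) ≤ d := by exact_mod_cast hd
      linarith
    have hS := sphereArea_pos hd
    have hpi := Real.pi_pos
    unfold freqFactor
    positivity
  have hcomp : ∀ m, h4Norm ((U - V) m) ^ 2 ≤ (e * M * A * δ) ^ 2 *
      (lpNormReal 1 (H m) ^ 2 * freqFactor d A + lpNormReal 2 (H m) ^ 2) := by
    intro m
    obtain ⟨wU, hwU, hU'⟩ := hU m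
    obtain ⟨wV, hwV, hV'⟩ := hV m
    have hpois : IsPoisson ((U - V) m) (wU - wV) := IsPoisson.sub hU' hV'
    set G : E d → ℝ := fun x => g m (evalVec a x) - g m (evalVec b x) with hG
    obtain ⟨hG1, hG2, hn1, hn2⟩ := hg.superposition_sub hr m ha hb
    have hw : (wU - wV : L2 d) =ᵐ[volume] fun x => ε m * ∫ y, H m (x - y) * G y := by
      filter_upwards [hwU, hwV, Lp.coeFn_sub wU wV] with x h1 h2 h3
      rw [h3, Pi.sub_apply, h1, h2, ← mul_sub, integralTerm, integralTerm, ← integral_sub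
        (integrable_sub_mul (hg.memLp_superposition hr m ha).2 (hH2 m) x)
        (integrable_sub_mul (hg.memLp_superposition hr m hb).2 (hH2 m) x)]
      simp only [hG, mul_sub]
    have hG1' : lpNormReal 1 G ≤ M * A * δ := by
      refine hn1.trans ?_
      calc M / 2 * (‖evalLp a‖ + ‖evalLp b‖) * ‖evalLp (a - b)‖
          ≤ M / 2 * (A + A) * δ := by gcongr
        _ = M * A * δ := by ring
    have hG2' : lpNormReal 2 G ≤ M * δ := hn2.trans (by gcongr)
    have hL1 := lpNormReal_nonneg 1 (H m)
    have hL2 := lpNormReal_nonneg 2 (H m)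
    have hεm := hε m
    have hee := hεe m
    have he : 0 ≤ e := hεm.trans hee
    have hscale : ∀ (p : ENNReal), lpNormReal p (wU - wV : L2 d)
        = ε m * lpNormReal p (fun x => ∫ y, H m (x - y) * G y) := fun p => by
      rw [lpNormReal_congr hw, lpNormReal_const_mul, abs_of_nonneg hεm]
    have hnorm : ‖wU - wV‖ = lpNormReal 2 (wU - wV : L2 d) := Lp.norm_def _
    -- β uses ‖H‖₁ with the L² bound Mδ for G, and A β matches its L¹ bound MAδ. γ uses ‖H‖₂ with
    -- the L¹ bound, so both terms share the factor (eMAδ)².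
    have key := hpois.h4Norm_sq_le hd
      (((memLp_one_conv (hH1 m) hG1).const_mul (ε m)).ae_eq hw.symm) hA
      (β := e * lpNormReal 1 (H m) * (M * δ)) (γ := e * lpNormReal 2 (H m) * (M * A * δ))
      (by
        rw [hscale]
        calc ε m * lpNormReal 1 (fun x => ∫ y, H m (x - y) * G y)
            ≤ e * (lpNormReal 1 (H m) * (M * A * δ)) := by
              gcongr
              · exact lpNormReal_nonneg _ _
              · exact (lpNormReal_one_conv_le (hH1 m) hG1).trans (by gcongr)
          _ = _ := by ring)
      (by
        rw [hnorm, hscale]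
        calc ε m * lpNormReal 2 (fun x => ∫ y, H m (x - y) * G y)
            ≤ e * (lpNormReal 1 (H m) * (M * δ)) := by
              gcongr
              · exact lpNormReal_nonneg _ _
              · exact (lpNormReal_two_conv_le (hH1 m) hG2).trans (by gcongr)
          _ = _ := by ring)
      (by
        rw [hnorm, hscale]
        calc ε m * lpNormReal 2 (fun x => ∫ y, H m (x - y) * G y)
            ≤ e * (lpNormReal 2 (H m) * (M * A * δ)) := by
              gcongr
              · exact lpNormReal_nonneg _ _
              · exact (lpNormReal_two_conv_le' (hH2 m) hG1).trans (by gcongr)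
          _ = _ := by ring)
    exact key.trans_eq (by ring)
  rw [h4NormVec, Real.sq_sqrt (Finset.sum_nonneg fun m _ => sq_nonneg _)]
  refine (Finset.sum_le_sum fun m _ => hcomp m).trans_eq ?_
  rw [← Finset.mul_sum, Finset.sum_add_distrib, ← Finset.sum_mul]
  rfl

theorem epsBound_eq (d : ℕ) (ρ M A H2 Q2 : ℝ) :
    epsBound d ρ M A H2 Q2
      = ρ / (M * A ^ 2) * (H2 * freqFactor d A + Q2) ^ (-(1 / 2) : ℝ) := by
  rw [epsBound, freqFactor]
  congr 3
  ring

/-- The bound on ε is solved for the squared Lipschitz constant, which becomes at most (ρ/A)². -/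
theorem sq_mul_le_of_le_rpow {e ρ M A K : ℝ} (he : 0 ≤ e) (hM : 0 < M) (hA : 0 < A)
    (hK : 0 < K) (h : e ≤ ρ / (M * A ^ 2) * K ^ (-(1 / 2) : ℝ)) :
    (e * M * A) ^ 2 * K ≤ (ρ / A) ^ 2 := by
  have h1 : (e * M * A) ^ 2 ≤ (ρ / A * K ^ (-(1 / 2) : ℝ)) ^ 2 := by
    refine pow_le_pow_left₀ (by positivity) ?_ 2
    calc e * M * A ≤ ρ / (M * A ^ 2) * K ^ (-(1 / 2) : ℝ) * M * A := by gcongr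
      _ = _ := by field_simp
  have h2 : (K ^ (-(1 / 2) : ℝ)) ^ 2 = K⁻¹ := by
    rw [← Real.rpow_mul_natCast hK.le, ← Real.rpow_neg_one]
    norm_num
  calc (e * M * A) ^ 2 * K ≤ (ρ / A * K ^ (-(1 / 2) : ℝ)) ^ 2 * K := by gcongr
    _ = (ρ / A) ^ 2 := by
      rw [mul_pow, h2]
      field_simp

end Estimates

/-! ### Banach's theorem transported along an injection -/

section FixedPoint

/-- Banach's fixed point theorem on a set that an injection identifies with a closed subset of a
complete space. -/
theorem exists_fixedPoint_of_embedding {X Y : Type*} [MetricSpace Y] [CompleteSpace Y]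
    [Nonempty X] {Φ : X → Y} (hΦ : Function.Injective Φ) (hclosed : IsClosed (Set.range Φ))
    {T : X → X} {q : ℝ} (hq0 : 0 ≤ q) (hq1 : q < 1)
    (hT : ∀ x y, dist (Φ (T x)) (Φ (T y)) ≤ q * dist (Φ x) (Φ y)) :
    ∃ x, ∀ y, T y = y ↔ y = x := by
  let _ : MetricSpace X := MetricSpace.induced Φ hΦ inferInstance
  have hiso : Isometry Φ := Isometry.of_dist_eq fun _ _ => rfl
  have : CompleteSpace X := hiso.isUniformInducing.completeSpace hclosed.isComplete
  have hc : ContractingWith ⟨q, hq0⟩ T :=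
    ⟨by exact_mod_cast hq1, LipschitzWith.of_dist_le_mul hT⟩
  refine ⟨ContractingWith.fixedPoint T hc, fun y => ⟨fun hy => hc.fixedPoint_unique hy, ?_⟩⟩
  rintro rfl
  exact hc.fixedPoint_isFixedPt

end FixedPoint

/-! ### The unperturbed solution and the stationary system -/

section Main

variable {d N : ℕ}

theorem exists_unique_solvesPoisson (hd : 5 ≤ d) {f : Fin N → E d → ℝ}
    (h1 : ∀ m, MemLp (f m) 1) (h2 : ∀ m, MemLp (f m) 2) :
    ∃! u₀ : Fin N → L2 d, MemH4Vec u₀ ∧ SolvesPoisson f u₀ := by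
  choose u hu using fun m => exists_solvesLinear hd (h1 m) (h2 m)
  exact ⟨u, ⟨fun m => (hu m).memH4, hu⟩, fun v hv =>
    funext fun m => (hv.2 m).unique hd (hu m)⟩

/-- If u vanished, so would f. Strict positivity gives A > 1, hence ρ/A < 1 even when ρ = 1. -/
theorem SolvesPoisson.h4NormVec_pos {f : Fin N → E d → ℝ} {u : Fin N → L2 d}
    (hu : SolvesPoisson f u) (hf : ∃ m, ¬ f m =ᵐ[volume] 0) : 0 < h4NormVec u := by
  refine lt_of_le_of_ne (h4NormVec_nonneg u) fun h => ?_
  obtain ⟨m, hm⟩ := hf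
  rw [← norm_graphMap, eq_comm, norm_eq_zero] at h
  have h0 : u m = 0 := congrArg (fun p : GraphSpace d N => (p m).fst) h
  obtain ⟨w, hw, hP⟩ := hu m
  rw [h0] at hP
  have h2 : toDist w = toDist 0 := hP.symm.trans isPoisson_zero
  rw [toDist_injective h2] at hw
  exact hm (hw.symm.trans (Lp.coeFn_zero ℝ 2 volume))

theorem isStationary_add {ε : Fin N → ℝ} {f H : Fin N → E d → ℝ} {g : Fin N → E N → ℝ}
    {u₀ u : Fin N → L2 d} (h₀ : SolvesPoisson f u₀) (h : SolvesPert ε H g u₀ u) :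
    IsStationary (fun m x => ε m * H m x) f g (u₀ + u) := by
  intro m
  obtain ⟨w₀, hw₀, hP₀⟩ := h₀ m
  obtain ⟨w, hw, hP⟩ := h m
  refine ⟨w + w₀, ?_, ?_⟩
  · filter_upwards [hw, hw₀, Lp.coeFn_add w w₀] with x h1 h2 h3
    rw [h3, Pi.add_apply, h1, h2]
    simp only [integralTerm, mul_assoc, integral_const_mul]
  · have hsum : IsPoisson ((u₀ + u) m) (w₀ + w) := IsPoisson.add hP₀ hP
    rw [add_comm w w₀, ← hsum]
    abel

end Main

end BiLaplace

/-! ### Assembly of the contraction argument -/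

theorem theorem1p3 (d N : ℕ) (hd5 : 5 ≤ d) (hd7 : d ≤ 7) (hN : 2 ≤ N)
    (f H : Fin N → BiLaplace.E d → ℝ) (hfH : BiLaplace.DataAssumption f H) :
    (∃ c : ℝ, BiLaplace.IsEmbeddingConst d c) ∧
    (∃! u₀ : Fin N → BiLaplace.L2 d, BiLaplace.MemH4Vec u₀ ∧ BiLaplace.SolvesPoisson f u₀) ∧
    ∀ c : ℝ, BiLaplace.IsEmbeddingConst d c →
    ∀ u₀ : Fin N → BiLaplace.L2 d, BiLaplace.MemH4Vec u₀ → BiLaplace.SolvesPoisson f u₀ →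
    ∀ (M : ℝ) (g : Fin N → BiLaplace.E N → ℝ),
      BiLaplace.NonlinAssumption (BiLaplace.ballI c u₀) M g →
    ∀ ρ : ℝ, 0 < ρ → ρ ≤ 1 →
    ∀ ε : Fin N → ℝ, (∀ m, 0 ≤ ε m) → 0 < (⨆ m, ε m) →
      (⨆ m, ε m) ≤ BiLaplace.epsBound d ρ M (BiLaplace.h4NormVec u₀ + 1)
        (BiLaplace.sumSqL1 H) (BiLaplace.sumSqL2 H) →
    ∃ T : BiLaplace.ballH4 d N ρ → BiLaplace.ballH4 d N ρ,
      (∀ (v : BiLaplace.ballH4 d N ρ) (u : Fin N → BiLaplace.L2 d), BiLaplace.MemH4Vec u →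
        (BiLaplace.SolvesAux ε H g u₀ v.1 u ↔ u = (T v).1)) ∧
      (∃ q : ℝ, 0 ≤ q ∧ q < 1 ∧ ∀ v₁ v₂ : BiLaplace.ballH4 d N ρ,
        BiLaplace.h4NormVec ((T v₁).1 - (T v₂).1) ≤ q * BiLaplace.h4NormVec (v₁.1 - v₂.1)) ∧
      ∃ u_p : BiLaplace.ballH4 d N ρ,
        (∀ v : BiLaplace.ballH4 d N ρ, T v = v ↔ v = u_p) ∧
        (∀ v : BiLaplace.ballH4 d N ρ, BiLaplace.SolvesPert ε H g u₀ v.1 ↔ v = u_p) ∧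
        BiLaplace.MemH4Vec (u₀ + u_p.1) ∧
        BiLaplace.IsStationary (fun m x => ε m * H m x) f g (u₀ + u_p.1) := by
  refine ⟨BiLaplace.exists_isEmbeddingConst hd7,
    BiLaplace.exists_unique_solvesPoisson hd5 hfH.f_L1 hfH.f_L2, ?_⟩
  intro c hc u₀ hu₀ hPu₀ M g hg ρ hρ0 hρ1 ε hε hε0 hεle
  have hn0 := hPu₀.h4NormVec_pos hfH.f_nontrivial
  set A : ℝ := BiLaplace.h4NormVec u₀ + 1 with hA
  have hA1 : 1 < A := by linarith
  have hA0 : 0 < A := by linarith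
  have hr : 0 < c * BiLaplace.h4NormVec u₀ + c := by
    have := hc.1
    positivity
  have hball : ∀ a : Fin N → BiLaplace.L2 d, BiLaplace.MemH4Vec a → BiLaplace.h4NormVec a ≤ A →
      ∀ᵐ x, BiLaplace.evalVec a x
        ∈ Metric.closedBall (0 : BiLaplace.E N) (c * BiLaplace.h4NormVec u₀ + c) := by
    intro a ha haA
    filter_upwards [hc.norm_evalVec_le ha] with x hx
    rw [mem_closedBall_zero_iff]
    calc ‖BiLaplace.evalVec a x‖ ≤ c * BiLaplace.h4NormVec a := hx
      _ ≤ c * A := mul_le_mul_of_nonneg_left haA hc.1.le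
      _ = c * BiLaplace.h4NormVec u₀ + c := by rw [hA]; ring
  have hεe : ∀ m, ε m ≤ ⨆ m, ε m := fun m => le_ciSup (Set.finite_range ε).bddAbove m
  have hd4 : (0 : ℝ) < d - 4 := by
    have : (5 : ℝ) ≤ d := by exact_mod_cast hd5
    linarith
  have hK : 0 < BiLaplace.sumSqL1 H * BiLaplace.freqFactor d A + BiLaplace.sumSqL2 H := by
    have h1 := hfH.H_pos
    have h2 := hfH.Q_pos
    have hS := BiLaplace.sphereArea_pos hd5
    have hpi := Real.pi_pos
    unfold BiLaplace.freqFactor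
    positivity
  rw [BiLaplace.epsBound_eq] at hεle
  have hsmall := BiLaplace.sq_mul_le_of_le_rpow hε0.le hg.M_pos hA0 hK hεle
  have hlip : ∀ a b U V : Fin N → BiLaplace.L2 d, BiLaplace.MemH4Vec a → BiLaplace.MemH4Vec b →
      BiLaplace.h4NormVec a ≤ A → BiLaplace.h4NormVec b ≤ A →
      BiLaplace.SolvesIntegral ε H g a U → BiLaplace.SolvesIntegral ε H g b V →
      BiLaplace.h4NormVec (U - V) ≤ ρ / A * BiLaplace.h4NormVec (a - b) := by
    intro a b U V ha hb haA hbA hU hV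
    have h1 := hU.h4NormVec_sub_sq_le hd5 hfH.H_L1 hfH.H_L2 hr hg hε hεe hA0
      (hball a ha haA) (hball b hb hbA) ((BiLaplace.norm_evalLp_le a).trans haA)
      ((BiLaplace.norm_evalLp_le b).trans hbA) (BiLaplace.norm_evalLp_le (a - b)) hV
    have hδ := BiLaplace.h4NormVec_nonneg (a - b)
    refine le_of_sq_le_sq (h1.trans ?_) (by positivity)
    rw [mul_pow (ρ / A)]
    refine le_trans (le_of_eq ?_) (mul_le_mul_of_nonneg_right hsmall (sq_nonneg _))
    ring
  have hsum : ∀ v : BiLaplace.ballH4 d N ρ,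
      BiLaplace.MemH4Vec (u₀ + v.1) ∧ BiLaplace.h4NormVec (u₀ + v.1) ≤ A := by
    intro v
    refine ⟨hu₀.add v.2.1, (BiLaplace.h4NormVec_add_le hu₀ v.2.1).trans ?_⟩
    linarith [v.2.2]
  choose S hS using fun v : BiLaplace.ballH4 d N ρ =>
    BiLaplace.exists_solvesIntegral (ε := ε) hd5 hfH.H_L1 hr hg
      (hball _ (hsum v).1 (hsum v).2)
  have hSρ : ∀ v, BiLaplace.h4NormVec (S v) ≤ ρ := by
    intro v
    -- The self-map property is the Lipschitz bound against the zero argument, whose solution is 0: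
    -- (ρ/A) · A = ρ.
    have h := hlip (u₀ + v.1) 0 (S v) 0 (hsum v).1 BiLaplace.memH4Vec_zero (hsum v).2
      (by rw [BiLaplace.h4NormVec_zero]; exact hA0.le) (hS v)
      (BiLaplace.solvesIntegral_zero hg.zero)
    rw [sub_zero, sub_zero] at h
    calc BiLaplace.h4NormVec (S v) ≤ ρ / A * BiLaplace.h4NormVec (u₀ + v.1) := h
      _ ≤ ρ / A * A := mul_le_mul_of_nonneg_left (hsum v).2 (by positivity)
      _ = ρ := by field_simp
  let T : BiLaplace.ballH4 d N ρ → BiLaplace.ballH4 d N ρ := fun v =>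
    ⟨S v, (hS v).memH4Vec, hSρ v⟩
  -- `SolvesAux` and `SolvesPert` both unfold to `SolvesIntegral` with argument u₀ + v, so this
  -- equivalence serves for the auxiliary and the perturbed system alike.
  have hT : ∀ (v : BiLaplace.ballH4 d N ρ) (u : Fin N → BiLaplace.L2 d),
      BiLaplace.SolvesIntegral ε H g (u₀ + v.1) u ↔ u = (T v).1 := fun v u =>
    ⟨fun h => h.unique hd5 (hS v), fun h => h ▸ hS v⟩
  have hcontr : ∀ v₁ v₂ : BiLaplace.ballH4 d N ρ, BiLaplace.h4NormVec ((T v₁).1 - (T v₂).1)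
      ≤ ρ / A * BiLaplace.h4NormVec (v₁.1 - v₂.1) := by
    intro v₁ v₂
    have h := hlip _ _ _ _ (hsum v₁).1 (hsum v₂).1 (hsum v₁).2 (hsum v₂).2 (hS v₁) (hS v₂)
    rwa [add_sub_add_left_eq_sub] at h
  have hq0 : 0 ≤ ρ / A := by positivity
  have hq1 : ρ / A < 1 := by
    rw [div_lt_one hA0]
    linarith
  have hne : Nonempty (BiLaplace.ballH4 d N ρ) :=
    ⟨0, BiLaplace.memH4Vec_zero, BiLaplace.h4NormVec_zero.trans_le hρ0.le⟩
  obtain ⟨u_p, hup⟩ := BiLaplace.exists_fixedPoint_of_embedding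
    (Φ := fun v : BiLaplace.ballH4 d N ρ => BiLaplace.graphMap v.1)
    (BiLaplace.graphMap_injective.comp Subtype.val_injective)
    (by
      have := BiLaplace.isClosed_graphMap_ball (d := d) (N := N) ρ
      rwa [Set.image_eq_range] at this)
    (T := T) hq0 hq1 (fun v₁ v₂ => by
      rw [dist_eq_norm, dist_eq_norm, ← BiLaplace.graphMap_sub (T v₁).2.1 (T v₂).2.1,
        ← BiLaplace.graphMap_sub v₁.2.1 v₂.2.1, BiLaplace.norm_graphMap, BiLaplace.norm_graphMap]
      exact hcontr v₁ v₂)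
  have hpert : ∀ v : BiLaplace.ballH4 d N ρ, BiLaplace.SolvesPert ε H g u₀ v.1 ↔ v = u_p :=
    fun v => (hT v v.1).trans (by rw [← hup v, Subtype.ext_iff, eq_comm])
  exact ⟨T, fun v u _ => hT v u, ⟨ρ / A, hq0, hq1, hcontr⟩, u_p, hup, hpert, hu₀.add u_p.2.1,
    BiLaplace.isStationary_add hPu₀ ((hpert u_p).mpr rfl)⟩
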